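/- **Standing notions.** Strings are finite binary strings. Let $h:\{0,1\}^*\to\{0,1\}^*$ be a length-preserving bijection computable in polynomial time and $B:\{0,1\}^*\to\{0,1\}$ a polynomial-time predicate that is a hard bit of $h$: for every sequence $(C_\ell)_\ell$ of Boolean circuits of size polynomial in $\ell$ and every $k\ge 1$, for all sufficiently large $\ell$, $$\Pr_{u\in\{0,1\}^\ell}\big[C_\ell(u)=B(h^{-1}(u))\big]\le \tfrac12+\ell^{-k}.$$ For $n\in\mathbb N$ put $m=n+1$ and $\ell=\lfloor n^{1/3}\rfloor$. For a system of sets $J_i\subseteq[n]$, $i\in[m]$, with $|J_i|=\ell$ and $|J_i\cap J_j|\le\log_2 m$ for $i\ne j$, let $g:\{0,1\}^n\to\{0,1\}^m$ be the map whose $i$-th bit is $g(a)_i=B(h^{-1}(a(J_i)))$, where $a(J_i)$ is the string of the bits of $a$ in the positions from $J_i$, in increasing order. A *uniform Student* is given by a standard number $c$ and polynomial-time functions $S_1,\dots,S_c,O$. On an input $a\in\{0,1\}^n$ and with advice $(\{J_i\}_i,b,w)$, where $b\in\{0,1\}^m$ and $w$ is a string, he makes up to $c$ queries. His $k$-th move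 is computed by $S_k$ from $a$, the advice and the replies $v^1,\dots,v^{k-1}$ obtained so far; it is either a query $i_k\in[m]$, which the Teacher answers by $v^k=h^{-1}(a(J_{i_k}))$, or the decision to ask no more. If $B(v^k)\ne b_{i_k}$ for some query, the computation is aborted and the result is undefined; otherwise the result is the number computed by $O$ from $a$, the advice and all replies. Let $L$ be a first-order language containing the language of Peano arithmetic, with an interpretation in $\mathbb N$ that extends the usual one, and let $\mathcal M$ be an $\aleph_1$-saturated model of the $L$-theory of $\mathbb N$. All arithmetical notions are interpreted in $\mathcal M$ by their definitions in arithmetic; finite sets and strings in the sense of $\mathcal M$ are coded by elements of $\mathcal M$. Let $n\in\mathcal M$ be non-standard, and let the following be elements of $\mathcal M$: a set system $\{J_i\}_{i\in[m]}$ with the above properties, a string $b\in\{0,1\}^m\setminus\mathrm{Rng}(g)$, and a string $w$ of length at most $n^k$ for some standard $k$. Let $F^{unif}_w$ be the family of all partial functions $\alpha:\{0,1\}^n\to\mathcal M$ that are computed in $\mathcal M$ by (standard) uniform Students with advice $(\{J_i\}_i,b,w)$. **Theorem.** There exists an infinite set $H\subseteq\{0,1\}^n$, $H\in\mathcal M$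 (that is, $H$ is finite in the sense of $\mathcal M$ and coded by an element of $\mathcal M$, but has infinitely many elements), such that each $\alpha\in F^{unif}_w$ is defined on all samples from $H$. -/

import Mathlib

open FirstOrder

universe u v x

namespace NWGame

/-! ### First-order arithmetic and its non-standard models -/

/-- Function symbols `0, 1, +, ·` of the language of Peano arithmetic. -/
inductive ArithFunc : ℕ → Type
  | zero : ArithFunc 0
  | one : ArithFunc 0
  | add : ArithFunc 2
  | mul : ArithFunc 2

/-- The relation symbol `<` of the language of Peano arithmetic. -/
inductive ArithRel : ℕ → Type
  | lt : ArithRel 2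

/-- The language of Peano arithmetic. -/
def arith : FirstOrder.Language.{0, 0} :=
  { Functions := ArithFunc
    Relations := ArithRel }

/-- The standard model of arithmetic. -/
instance : arith.Structure ℕ where
  funMap := fun {_} f => match f with
    | .zero => fun _ => 0
    | .one => fun _ => 1
    | .add => fun v => v 0 + v 1
    | .mul => fun v => v 0 * v 1
  RelMap := fun {_} r => match r with
    | .lt => fun v => v 0 < v 1

/-- `ℵ₁`-saturation: every set of formulas in one free variable, with parameters from a countable
set `A`, that is finitely satisfiable in `M` is realized in `M`. -/
def IsAleph1Saturated (L : FirstOrder.Language) (M : Type*) [L.Structure M] : Prop :=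
  ∀ A : Set M, A.Countable → ∀ Γ : Set (L[[A]].Formula (Fin 1)),
    (∀ Γ₀ : Finset (L[[A]].Formula (Fin 1)), (Γ₀ : Set (L[[A]].Formula (Fin 1))) ⊆ Γ →
      ∃ x : M, ∀ φ ∈ Γ₀, φ.Realize ![x]) →
    ∃ x : M, ∀ φ ∈ Γ, φ.Realize ![x]

/-- `Holds L M R x`: the tuple `x` of elements of `M` satisfies the interpretation in `M` of the
`L`-definable relation `R` on the natural numbers, i.e. it satisfies in `M` an `L`-formula
(without parameters) that defines `R` in the standard model. When `M` is a model of true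
arithmetic this does not depend on the formula, see `holds_iff`. -/
def Holds (L : FirstOrder.Language) (M : Type*) [L.Structure ℕ] [L.Structure M] {k : ℕ}
    (R : (Fin k → ℕ) → Prop) (x : Fin k → M) : Prop :=
  ∃ φ : L.Formula (Fin k), (∀ v : Fin k → ℕ, φ.Realize v ↔ R v) ∧ φ.Realize x

theorem holds_iff {L : FirstOrder.Language} {M : Type*} [L.Structure ℕ] [L.Structure M]
    (hM : M ⊨ L.completeTheory ℕ) {k : ℕ} {R : (Fin k → ℕ) → Prop} (φ : L.Formula (Fin k))
    (hφ : ∀ v : Fin k → ℕ, φ.Realize v ↔ R v) (x : Fin k → M) :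
    Holds L M R x ↔ φ.Realize x := by
  refine ⟨?_, fun h => ⟨φ, hφ, h⟩⟩
  rintro ⟨ψ, hψ, hx⟩
  have h1 : (((ψ.iff φ).relabel (Sum.inr : Fin k → Empty ⊕ Fin k)).iAlls (Fin k) : L.Sentence) ∈
      L.completeTheory ℕ := by
    rw [FirstOrder.Language.mem_completeTheory, FirstOrder.Language.Sentence.Realize,
      FirstOrder.Language.Formula.realize_iAlls]
    intro v
    rw [FirstOrder.Language.Formula.realize_relabel, FirstOrder.Language.Formula.realize_iff,
      hψ, hφ]
  have h2 := hM.realize_of_mem _ h1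
  rw [FirstOrder.Language.Sentence.Realize, FirstOrder.Language.Formula.realize_iAlls] at h2
  have h3 := h2 x
  rw [FirstOrder.Language.Formula.realize_relabel, FirstOrder.Language.Formula.realize_iff] at h3
  exact h3.1 hx

/-- `n` is a non-standard element of `M`: it is not the value of a numeral. -/
def IsNonstandard (L : FirstOrder.Language) {M : Type*} [L.Structure ℕ] [L.Structure M] (n : M) : Prop :=
  ∀ k : ℕ, ¬ Holds L M (fun v : Fin 1 → ℕ => v 0 = k) ![n]

/-- `x` is, in the sense of `M`, a binary string of length `n`. A string of a given length `n` is
coded by the number `x < 2 ^ n` whose `j`-th binary digit is the `j`-th bit of the string. -/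
def IsString (L : FirstOrder.Language) {M : Type*} [L.Structure ℕ] [L.Structure M] (n x : M) : Prop :=
  Holds L M (fun v : Fin 2 → ℕ => v 1 < 2 ^ v 0) ![n, x]

/-- The set of elements of `M` that is coded by `H` in `M`: `x` belongs to it if, in the sense
of `M`, the `x`-th binary digit of `H` is `1`. These are exactly the subsets of `M` that are
finite in the sense of `M`. -/
def codedSet (L : FirstOrder.Language) {M : Type*} [L.Structure ℕ] [L.Structure M] (H : M) : Set M :=
  {x | Holds L M (fun v : Fin 2 → ℕ => (v 0).testBit (v 1) = true) ![H, x]}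

/-! ### Strings, polynomial time, circuits, hard bits -/

/-- The binary string of length `n` coded by `x`. -/
def bits (n x : ℕ) : List Bool := (List.range n).map fun j => x.testBit j

/-- The number written in binary by a string, least significant bit first. -/
def ofBits (s : List Bool) : ℕ := s.foldr Nat.bit 0

/-- A finite sequence of strings as one string: every bit `x` becomes `1x` and every string of
the sequence is followed by `0`. -/
def encodeTuple (l : List (List Bool)) : List Bool :=
  l.flatMap fun s => s.flatMap (fun x => [true, x]) ++ [false]

/-- Functions on binary strings computed by a Turing machine in polynomial time. -/
def PolyTime (f : List Bool → List Bool) : Prop :=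
  Nonempty (Turing.TM2ComputableInPolyTime (id : List Bool → List Bool) id f)

/-- Gates of a Boolean circuit; the arguments are the numbers of wires. -/
inductive Gate
  | const (c : Bool) : Gate
  | not (i : ℕ) : Gate
  | and (i j : ℕ) : Gate
  | or (i j : ℕ) : Gate

/-- The value of a gate, given the values of the wires (a wire that does not exist carries
`false`). -/
def Gate.eval (ws : List Bool) : Gate → Bool
  | .const c => c
  | .not i => !(ws.getD i false)
  | .and i j => ws.getD i false && ws.getD j false
  | .or i j => ws.getD i false || ws.getD j false

/-- A Boolean circuit is a sequence of gates. The wires are first the inputs, then the outputs of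
the gates in this order; so every gate reads inputs and previous gates. -/
abbrev Circuit := List Gate

/-- The output of a circuit on an input is the value of its last wire. -/
def Circuit.eval (C : Circuit) (u : List Bool) : Bool :=
  (C.foldl (fun ws g => ws ++ [g.eval ws]) u).getLastD false

/-- `B` is a hard bit of the permutation `h`: for every sequence of circuits of polynomial size
and every `k ≥ 1`, for all sufficiently large `ℓ` the circuit computes `B (h⁻¹ u)` from
`u ∈ {0,1}^ℓ` with advantage at most `ℓ ^ (-k)` over `1/2`. -/
def IsHardBit (h : Equiv.Perm (List Bool)) (B : List Bool → Bool) : Prop :=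
  ∀ C : ℕ → Circuit, (∃ q : Polynomial ℕ, ∀ ℓ, (C ℓ).length ≤ q.eval ℓ) →
    ∀ k : ℕ, 1 ≤ k → ∀ᶠ ℓ : ℕ in Filter.atTop,
      ((Finset.univ.filter fun u : Fin ℓ → Bool =>
          (C ℓ).eval (List.ofFn u) = B (h.symm (List.ofFn u))).card : ℝ) / 2 ^ ℓ
        ≤ 1 / 2 + 1 / (ℓ : ℝ) ^ k

/-! ### The generator and the game

The parameters are `m = n + 1`, `ℓ = ⌊n^{1/3}⌋` and `d = ⌊log₂ m⌋`. A system of subsets `J_i`,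
`i < m`, of `{0, …, n - 1}` is coded by its incidence matrix, a string `J` of length `m * n`:
`j ∈ J_i` if and only if the bit `i * n + j` of `J` is `1`. -/

/-- The set `J_i ⊆ {0, …, n - 1}`. -/
def row (n J i : ℕ) : Finset ℕ := (Finset.range n).filter fun j => J.testBit (i * n + j) = true

/-- The string `a(J_i)`: the bits of `a` in the positions `j ∈ J_i`, in increasing order. -/
def restrict (n J i a : ℕ) : List Bool :=
  ((List.range n).filter fun j => J.testBit (i * n + j)).map fun j => a.testBit j

/-- `J` codes a system of `m = n + 1` subsets of `{0, …, n - 1}`, each of size `⌊n^{1/3}⌋`, any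
two of which meet in at most `log₂ m` points. -/
def IsSetSystem (n J : ℕ) : Prop :=
  J < 2 ^ ((n + 1) * n) ∧
  (∀ i < n + 1, (row n J i).card = Nat.nthRoot 3 n) ∧
  ∀ i < n + 1, ∀ j < n + 1, i ≠ j → (row n J i ∩ row n J j).card ≤ Nat.log 2 (n + 1)

/-- The bit `g(a)_i = B (h⁻¹ (a(J_i)))` of the Nisan-Wigderson generator. -/
def genBit (h : Equiv.Perm (List Bool)) (B : List Bool → Bool) (n J a i : ℕ) : Bool :=
  B (h.symm (restrict n J i a))

/-- `b` is a string of length `m = n + 1` outside of the range of `g : {0,1}^n → {0,1}^m`. -/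
def IsOutsideRange (h : Equiv.Perm (List Bool)) (B : List Bool → Bool) (n J b : ℕ) : Prop :=
  b < 2 ^ (n + 1) ∧ ¬ ∃ a < 2 ^ n, ∀ i < n + 1, genBit h B n J a i = b.testBit i

/-- A uniform Student asking at most `c = moves.length` queries: polynomial time functions that
compute his successive moves and his final output. -/
structure Student where
  moves : List (List Bool → List Bool)
  out : List Bool → List Bool
  polyTime_moves : ∀ S ∈ moves, PolyTime S
  polyTime_out : PolyTime out

/-- The computation in which the moves still to be made are computed by the functions in the
list, `inp` are the strings available at the beginning and `ys` are the Teacher's replies so far.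
A move `i < m` is the query about `h⁻¹ (a(J_i))`; the computation is aborted (`none`) if the reply
`v` does not satisfy `B v = b_i`. A move that is not in this range means that the Student asks no
more queries. The Student who was not aborted finally outputs a number. -/
def play (h : Equiv.Perm (List Bool)) (B : List Bool → Bool) (n J b a : ℕ)
    (inp : List (List Bool)) (out : List Bool → List Bool) :
    List (List Bool → List Bool) → List (List Bool) → Option ℕ
  | [], ys => some (ofBits (out (encodeTuple (inp ++ ys))))
  | S :: Ss, ys =>
    let i := ofBits (S (encodeTuple (inp ++ ys)))
    if i < n + 1 then
      let v := h.symm (restrict n J i a)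
      if B v = b.testBit i then play h B n J b a inp out Ss (ys ++ [v]) else none
    else some (ofBits (out (encodeTuple (inp ++ ys))))

/-- The result of the Student's computation on the sample `a ∈ {0,1}^n`, with advice the set system
`J`, the string `b` and the string `w` of length `p`; `none` if the computation is aborted. -/
def Student.result (S : Student) (h : Equiv.Perm (List Bool)) (B : List Bool → Bool)
    (n J b p w a : ℕ) : Option ℕ :=
  play h B n J b a [bits n a, bits ((n + 1) * n) J, bits (n + 1) b, bits p w] S.out S.moves []

/-- The family `F^unif_w` of partial random variables on `{0,1}^n` computed, in the sense of `M`,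
by uniform Students with the advice `J`, `b`, `w` (where `w` is a string of length `p`). -/
def uniformFamily (L : FirstOrder.Language) {M : Type*} [L.Structure ℕ] [L.Structure M]
    (h : Equiv.Perm (List Bool)) (B : List Bool → Bool) (n J b p w : M) : Set (M →. M) :=
  {α | ∃ S : Student, ∀ x y : M, y ∈ α x ↔
    IsString L n x ∧
    Holds L M (fun v : Fin 7 → ℕ =>
      S.result h B (v 0) (v 1) (v 2) (v 3) (v 4) (v 5) = some (v 6)) ![n, J, b, p, w, x, y]}

end NWGame

open NWGame

namespace NWGame

/-! ### A normal form of polynomial time machines -/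

/-- A machine with finitely many stacks over one finite alphabet. A step depends on the state and on
the `depth` topmost symbols of every stack, which it replaces by other symbols. -/
structure StackMachine where
  states : ℕ
  tapes : ℕ
  symbols : ℕ
  depth : ℕ
  trans : Fin states → (Fin tapes → Fin depth → Option (Fin symbols)) →
    Fin states × (Fin tapes → List (Fin symbols))

namespace StackMachine

/-- The configurations: a state and the contents of the stacks. -/
abbrev Config (T : StackMachine) : Type := Fin T.states × (Fin T.tapes → List (Fin T.symbols))

/-- The part of a configuration that determines the next step. -/
def view (T : StackMachine) (c : T.Config) :
    Fin T.states × (Fin T.tapes → Fin T.depth → Option (Fin T.symbols)) :=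
  (c.1, fun k j => (c.2 k)[(j : ℕ)]?)

def step (T : StackMachine) (c : T.Config) : T.Config :=
  ((T.trans (T.view c).1 (T.view c).2).1,
    fun k => (T.trans (T.view c).1 (T.view c).2).2 k ++ (c.2 k).drop T.depth)

/-- The configuration with the word `w` on the stack `k` and all other stacks empty. -/
def initial (T : StackMachine) (q : Fin T.states) (k : Fin T.tapes) (w : List (Fin T.symbols)) :
    T.Config :=
  (q, fun k' => if k' = k then w else [])

end StackMachine

open Turing TM2

section Locality

variable {K : Type} {Γ : K → Type} {Λ σ : Type}

/-- The number of operations in a statement. -/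
def stmtDepth : Stmt Γ Λ σ → ℕ
  | .push _ _ q => stmtDepth q + 1
  | .peek _ _ q => stmtDepth q + 1
  | .pop _ _ q => stmtDepth q + 1
  | .load _ q => stmtDepth q + 1
  | .branch _ q₁ q₂ => stmtDepth q₁ + stmtDepth q₂ + 1
  | .goto _ => 0
  | .halt => 0

/-- The symbols that a statement can push. -/
def pushedSymbols : Stmt Γ Λ σ → Set (Σ k, Γ k)
  | .push k f q => Set.range (fun v => (⟨k, f v⟩ : Σ k, Γ k)) ∪ pushedSymbols q
  | .peek _ _ q => pushedSymbols q
  | .pop _ _ q => pushedSymbols q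
  | .load _ q => pushedSymbols q
  | .branch _ q₁ q₂ => pushedSymbols q₁ ∪ pushedSymbols q₂
  | .goto _ => ∅
  | .halt => ∅

theorem finite_pushedSymbols [Finite σ] (q : Stmt Γ Λ σ) : (pushedSymbols q).Finite := by
  induction q with
  | push k f q ih => exact (Set.finite_range _).union ih
  | peek k f q ih => exact ih
  | pop k f q ih => exact ih
  | load f q ih => exact ih
  | branch f q₁ q₂ ih₁ ih₂ => exact ih₁.union ih₂
  | goto f => exact Set.finite_empty
  | halt => exact Set.finite_empty

variable [DecidableEq K]

theorem stepAux_append (q : Stmt Γ Λ σ) (v : σ) (A R : ∀ k, List (Γ k))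
    (h : ∀ k, stmtDepth q ≤ (A k).length ∨ R k = []) :
    stepAux q v (fun k => A k ++ R k) =
      ⟨(stepAux q v A).l, (stepAux q v A).var, fun k => (stepAux q v A).stk k ++ R k⟩ := by
  induction q generalizing v A with
  | push k f q ih =>
    simp only [stepAux]
    rw [← ih]
    · congr 1
      funext k'
      by_cases hk : k' = k
      · subst hk; simp
      · simp [hk]
    · intro k'
      by_cases hk : k' = k
      · subst hk
        refine (h k').imp_left fun h => ?_
        simp only [stmtDepth, Function.update_self, List.length_cons] at *
        omega
      · refine (h k').imp_left fun h => ?_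
        simp only [stmtDepth, ne_eq, hk, not_false_eq_true, Function.update_of_ne] at *
        omega
  | peek k f q ih =>
    simp only [stepAux]
    have hh : (A k ++ R k).head? = (A k).head? := by
      rcases h k with h | h
      · cases hA : A k with
        | nil => simp [hA, stmtDepth] at h
        | cons => rfl
      · simp [h]
    rw [hh, ih]
    intro k'
    refine (h k').imp_left fun h => ?_
    simp only [stmtDepth] at h
    omega
  | pop k f q ih =>
    simp only [stepAux]
    have hh : (A k ++ R k).head? = (A k).head? := by
      rcases h k with h | h
      · cases hA : A k with
        | nil => simp [hA, stmtDepth] at h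
        | cons => rfl
      · simp [h]
    have ht : (A k ++ R k).tail = (A k).tail ++ R k := by
      rcases h k with h | h
      · cases hA : A k with
        | nil => simp [hA, stmtDepth] at h
        | cons => rfl
      · simp [h]
    rw [hh, ← ih]
    · congr 1
      funext k'
      by_cases hk : k' = k
      · subst hk; simp [ht]
      · simp [hk]
    · intro k'
      by_cases hk : k' = k
      · subst hk
        refine (h k').imp_left fun h => ?_
        simp only [stmtDepth, Function.update_self, List.length_tail] at *
        omega
      · refine (h k').imp_left fun h => ?_
        simp only [stmtDepth, ne_eq, hk, not_false_eq_true, Function.update_of_ne] at *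
        omega
  | load f q ih =>
    simp only [stepAux]
    rw [ih]
    intro k'
    refine (h k').imp_left fun h => ?_
    simp only [stmtDepth] at h
    omega
  | branch f q₁ q₂ ih₁ ih₂ =>
    simp only [stepAux]
    cases f v
    · simp only [cond_false]
      rw [ih₂]
      intro k'
      refine (h k').imp_left fun h => ?_
      simp only [stmtDepth] at h
      omega
    · simp only [cond_true]
      rw [ih₁]
      intro k'
      refine (h k').imp_left fun h => ?_
      simp only [stmtDepth] at h
      omega
  | goto f => simp [stepAux]
  | halt => simp [stepAux]

theorem stepAux_mem (E : Set (Σ k, Γ k)) (q : Stmt Γ Λ σ) (hq : pushedSymbols q ⊆ E) (v : σ)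
    (S : ∀ k, List (Γ k)) (hS : ∀ k, ∀ γ ∈ S k, (⟨k, γ⟩ : Σ k, Γ k) ∈ E) :
    ∀ k, ∀ γ ∈ (stepAux q v S).stk k, (⟨k, γ⟩ : Σ k, Γ k) ∈ E := by
  induction q generalizing v S with
  | push k f q ih =>
    refine ih (fun x hx => hq (Or.inr hx)) _ _ fun k' γ hγ => ?_
    by_cases hk : k' = k
    · subst hk
      simp only [Function.update_self, List.mem_cons] at hγ
      rcases hγ with rfl | hγ
      · exact hq (Or.inl ⟨v, rfl⟩)
      · exact hS _ _ hγ
    · simp only [ne_eq, hk, not_false_eq_true, Function.update_of_ne] at hγ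
      exact hS _ _ hγ
  | peek k f q ih => exact ih hq _ _ hS
  | pop k f q ih =>
    refine ih hq _ _ fun k' γ hγ => ?_
    by_cases hk : k' = k
    · subst hk
      simp only [Function.update_self] at hγ
      exact hS _ _ (List.mem_of_mem_tail hγ)
    · simp only [ne_eq, hk, not_false_eq_true, Function.update_of_ne] at hγ
      exact hS _ _ hγ
  | load f q ih => exact ih hq _ _ hS
  | branch f q₁ q₂ ih₁ ih₂ =>
    simp only [stepAux]
    cases f v
    · exact ih₂ (fun x hx => hq (Or.inr hx)) _ _ hS
    · exact ih₁ (fun x hx => hq (Or.inl hx)) _ _ hS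
  | goto f => exact hS
  | halt => exact hS

end Locality

theorem getD_iterate_of_bind_iterate {α : Type*} (f : α → Option α) {a b : α} {n : ℕ}
    (h : (flip bind f)^[n] (some a) = some b) : (fun c => (f c).getD c)^[n] a = b := by
  induction n generalizing a with
  | zero => simpa using h
  | succ n ih =>
    rw [Function.iterate_succ_apply] at h ⊢
    have hf : flip bind f (some a) = f a := rfl
    rw [hf] at h
    cases hfa : f a with
    | some a' => rw [hfa] at h; simpa using ih h
    | none =>
      rw [hfa] at h
      have : ∀ n, (flip bind f)^[n] none = none := fun n => by
        induction n with
        | zero => rfl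
        | succ n ih => rw [Function.iterate_succ_apply']; rw [ih]; rfl
      rw [this] at h
      cases h

theorem reduceOption_ofFn_getElem? {α : Type*} (l : List α) (d : ℕ) :
    (List.ofFn fun j : Fin d => l[(j : ℕ)]?).reduceOption = l.take d := by
  induction d generalizing l with
  | zero => simp
  | succ d ih =>
    cases l with
    | nil =>
      have := ih []
      simp only [List.getElem?_nil, List.take_nil] at this ⊢
      rw [List.ofFn_succ, List.reduceOption_cons_of_none, this]
    | cons a l =>
      rw [List.ofFn_succ]
      simp only [Fin.val_zero, List.getElem?_cons_zero, Fin.val_succ, List.getElem?_cons_succ,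
        List.take_succ_cons]
      rw [List.reduceOption_cons_of_some, ih]

/-- Functions computed in polynomial time are computed by a stack machine that is run for a
polynomial number of steps. -/
theorem PolyTime.exists_stackMachine {f : List Bool → List Bool} (hf : PolyTime f) :
    ∃ (T : StackMachine) (q : Fin T.states) (k₀ k₁ : Fin T.tapes) (enc : Bool → Fin T.symbols)
      (dec : Fin T.symbols → Bool) (time : Polynomial ℕ),
      ∀ x, (((T.step)^[time.eval x.length] (T.initial q k₀ (x.map enc))).2 k₁).map dec = f x := by
  classical
  obtain ⟨⟨⟨tm, ein, eout⟩, time, hout⟩⟩ := hf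
  let := tm.kFin
  let := tm.ΛFin
  let := tm.σFin
  let := tm.Γk₀Fin
  let E : Set (Σ k, tm.Γ k) := (⋃ l, pushedSymbols (tm.m l)) ∪
    Set.range (fun γ : tm.Γ tm.k₀ => (⟨tm.k₀, γ⟩ : Σ k, tm.Γ k))
  have hE : E.Finite :=
    (Set.finite_iUnion fun l => finite_pushedSymbols _).union (Set.finite_range _)
  let : Fintype E := hE.fintype
  let eK := Fintype.equivFin tm.K
  let eQ := Fintype.equivFin (Option tm.Λ × tm.σ)
  let eA := Fintype.equivFin (Option E)
  let cA : (Σ k, tm.Γ k) → Fin (Fintype.card (Option E)) := fun s =>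
    eA (if h : s ∈ E then some ⟨s, h⟩ else none)
  let dA : (k : tm.K) → Fin (Fintype.card (Option E)) → Option (tm.Γ k) := fun k a =>
    (eA.symm a).bind fun s => if h : s.1.1 = k then some (h ▸ s.1.2) else none
  have hdA : ∀ k γ, (⟨k, γ⟩ : Σ k, tm.Γ k) ∈ E → dA k (cA ⟨k, γ⟩) = some γ := by
    intro k γ h
    simp [dA, cA, h]
  let depth := ∑ l, stmtDepth (tm.m l)
  let encS : (∀ k, List (tm.Γ k)) → Fin (Fintype.card tm.K) → List (Fin (Fintype.card (Option E))) :=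
    fun S k => (S (eK.symm k)).map fun γ => cA ⟨eK.symm k, γ⟩
  let encC : TM2.Cfg tm.Γ tm.Λ tm.σ →
      Fin (Fintype.card (Option tm.Λ × tm.σ)) ×
        (Fin (Fintype.card tm.K) → List (Fin (Fintype.card (Option E)))) :=
    fun c => (eQ (c.l, c.var), encS c.stk)
  let total : TM2.Cfg tm.Γ tm.Λ tm.σ → TM2.Cfg tm.Γ tm.Λ tm.σ := fun c => (TM2.step tm.m c).getD c
  let T : StackMachine :=
    { states := Fintype.card (Option tm.Λ × tm.σ)
      tapes := Fintype.card tm.K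
      symbols := Fintype.card (Option E)
      depth := depth
      trans := fun q t => encC (total ⟨(eQ.symm q).1, (eQ.symm q).2, fun k =>
        ((List.ofFn (t (eK k))).reduceOption).filterMap (dA k)⟩) }
  let good : TM2.Cfg tm.Γ tm.Λ tm.σ → Prop := fun c =>
    ∀ k, ∀ γ ∈ c.stk k, (⟨k, γ⟩ : Σ k, tm.Γ k) ∈ E
  have hgood : ∀ c, good c → good (total c) := by
    rintro ⟨_ | l, v, S⟩ h
    · exact h
    · exact stepAux_mem E (tm.m l) (fun s hs => Or.inl (Set.mem_iUnion.2 ⟨l, hs⟩)) v S h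
  have htotal : ∀ c : TM2.Cfg tm.Γ tm.Λ tm.σ, total c =
      ⟨(total ⟨c.l, c.var, fun k => (c.stk k).take depth⟩).l,
       (total ⟨c.l, c.var, fun k => (c.stk k).take depth⟩).var,
       fun k => (total ⟨c.l, c.var, fun k => (c.stk k).take depth⟩).stk k ++
        (c.stk k).drop depth⟩ := by
    rintro ⟨_ | l, v, S⟩
    · simp [total]
    · have := stepAux_append (tm.m l) v (fun k => (S k).take depth) (fun k => (S k).drop depth) ?_
      · simpa [total] using this
      · intro k
        by_cases h : depth ≤ (S k).length
        · left
          rw [List.length_take, min_eq_left h]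
          exact Finset.single_le_sum (f := fun l => stmtDepth (tm.m l)) (fun _ _ => Nat.zero_le _)
            (Finset.mem_univ l)
        · right
          exact List.drop_eq_nil_of_le (by omega)
  have hstep : ∀ c, good c → T.step (encC c) = encC (total c) := by
    intro c hc
    have hview : T.trans (T.view (encC c)).1 (T.view (encC c)).2 =
        encC (total ⟨c.l, c.var, fun k => (c.stk k).take depth⟩) := by
      change encC (total ⟨(eQ.symm (encC c).1).1, (eQ.symm (encC c).1).2, fun k =>
        ((List.ofFn (fun j : Fin depth => ((encC c).2 (eK k))[(j : ℕ)]?)).reduceOption).filterMap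
          (dA k)⟩) = _
      congr 2
      have h1 : eQ.symm (encC c).1 = (c.l, c.var) := by simp [encC]
      rw [h1]
      congr 1
      funext k
      rw [reduceOption_ofFn_getElem?]
      simp only [encC, encS]
      rw [Equiv.symm_apply_apply, ← List.map_take, List.filterMap_map, List.filterMap_congr (g := some), List.filterMap_some]
      intro γ hγ
      exact hdA k γ (hc k γ (List.mem_of_mem_take hγ))
    unfold StackMachine.step
    rw [hview, htotal c]
    simp only [encC, encS, List.map_append, List.map_drop]
    rfl
  have hiter : ∀ n c, good c → (T.step)^[n] (encC c) = encC (total^[n] c) := by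
    intro n
    induction n with
    | zero => intro c _; rfl
    | succ n ih =>
      intro c hc
      rw [Function.iterate_succ_apply, Function.iterate_succ_apply, hstep c hc, ih _ (hgood c hc)]
  refine ⟨T, eQ (some tm.main, tm.initialState), eK tm.k₀, eK tm.k₁,
    fun x => cA ⟨tm.k₀, ein.symm x⟩, fun a => ((dA tm.k₁ a).map eout).getD false, time, fun x => ?_⟩
  have hinit : T.initial (eQ (some tm.main, tm.initialState)) (eK tm.k₀)
      (x.map fun x => cA ⟨tm.k₀, ein.symm x⟩) = encC (initList tm (x.map ein.symm)) := by
    refine Prod.ext rfl ?_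
    funext k
    obtain ⟨k, rfl⟩ := eK.surjective k
    change (if eK k = eK tm.k₀ then _ else _) = ((initList tm (x.map ein.symm)).stk _).map _
    rw [Equiv.symm_apply_apply]
    by_cases hk : k = tm.k₀
    · subst hk
      simp [initList]
    · simp [initList, hk]
  have hgi : good (initList tm (x.map ein.symm)) := by
    intro k γ hγ
    by_cases hk : k = tm.k₀
    · subst hk
      exact Or.inr ⟨γ, rfl⟩
    · simp [initList, hk] at hγ
  obtain ⟨c₁, hc₁⟩ : ∃ c : TM2.Cfg tm.Γ tm.Λ tm.σ, c = haltList tm ((f x).map eout.symm) := ⟨_, rfl⟩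
  obtain ⟨c₀, hc₀⟩ : ∃ c : TM2.Cfg tm.Γ tm.Λ tm.σ, c = initList tm (x.map ein.symm) := ⟨_, rfl⟩
  have hrun : total^[time.eval x.length] c₀ = c₁ := by
    obtain ⟨⟨steps, hsteps⟩, hle⟩ := hout x
    have h1 := getD_iterate_of_bind_iterate _ hsteps
    have h2 : ∀ n, total^[n] c₁ = c₁ := fun n => by
      induction n with
      | zero => rfl
      | succ n ih => rw [Function.iterate_succ_apply', ih, hc₁]; rfl
    have h3 : total^[steps] c₀ = c₁ := by rw [hc₀, hc₁]; exact h1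
    simp only [id] at hle
    rw [← Nat.sub_add_cancel hle, Function.iterate_add_apply, h3, h2]
  rw [← hc₀] at hinit
  have hgi : good c₀ := by rw [hc₀]; exact hgi
  have hgr : ∀ n, good (total^[n] c₀) := fun n => by
    induction n with
    | zero => exact hgi
    | succ n ih => rw [Function.iterate_succ_apply']; exact hgood _ ih
  have hge := hgr (time.eval x.length)
  rw [hrun] at hge
  rw [hinit, hiter _ _ hgi, hrun]
  have hk1 : c₁.stk tm.k₁ = (f x).map eout.symm := by
    simp [hc₁, haltList]
  change ((c₁.stk (eK.symm (eK tm.k₁))).map _).map _ = _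
  rw [Equiv.symm_apply_apply]
  have hge' := hge tm.k₁
  rw [hk1] at hge' ⊢
  rw [List.map_map, List.map_map]
  conv_rhs => rw [← List.map_id (f x)]
  refine List.map_congr_left fun y hy => ?_
  simp only [Function.comp]
  rw [hdA _ _ (hge' _ (List.mem_map_of_mem hy))]
  simp

end NWGame

namespace NWGame

/-! ### Definable relations and functions on the natural numbers -/

/-- The relation `R` is defined in the standard model by an `L`-formula without parameters. -/
def IsDef (L : FirstOrder.Language) [L.Structure ℕ] {α : Type} (R : (α → ℕ) → Prop) : Prop :=
  ∃ φ : L.Formula α, ∀ v, φ.Realize v ↔ R v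

/-- The function `f` has a definable graph. -/
def IsDefFun (L : FirstOrder.Language) [L.Structure ℕ] {α : Type} (f : (α → ℕ) → ℕ) : Prop :=
  IsDef L fun v : α ⊕ Unit → ℕ => f (v ∘ Sum.inl) = v (Sum.inr ())

section Definability

variable {L : FirstOrder.Language} [L.Structure ℕ] {α β γ : Type}

namespace IsDef

theorem of_iff {R R' : (α → ℕ) → Prop} (h : IsDef L R) (hR : ∀ v, R' v ↔ R v) : IsDef L R' := by
  obtain ⟨φ, hφ⟩ := h
  exact ⟨φ, fun v => (hφ v).trans (hR v).symm⟩

theorem relabel {R : (α → ℕ) → Prop} (h : IsDef L R) (g : α → β) :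
    IsDef L fun v : β → ℕ => R (v ∘ g) := by
  obtain ⟨φ, hφ⟩ := h
  exact ⟨φ.relabel g, fun v => by rw [Language.Formula.realize_relabel, hφ]⟩

theorem not {R : (α → ℕ) → Prop} (h : IsDef L R) : IsDef L fun v => ¬ R v := by
  obtain ⟨φ, hφ⟩ := h
  exact ⟨φ.not, fun v => by rw [Language.Formula.realize_not, hφ]⟩

theorem and {R R' : (α → ℕ) → Prop} (h : IsDef L R) (h' : IsDef L R') :
    IsDef L fun v => R v ∧ R' v := by
  obtain ⟨φ, hφ⟩ := h
  obtain ⟨φ', hφ'⟩ := h'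
  exact ⟨φ ⊓ φ', fun v => by rw [Language.Formula.realize_inf, hφ, hφ']⟩

theorem imp {R R' : (α → ℕ) → Prop} (h : IsDef L R) (h' : IsDef L R') :
    IsDef L fun v => R v → R' v := by
  obtain ⟨φ, hφ⟩ := h
  obtain ⟨φ', hφ'⟩ := h'
  exact ⟨φ.imp φ', fun v => by rw [Language.Formula.realize_imp, hφ, hφ']⟩

theorem forall_finite [Finite β] {R : β → (α → ℕ) → Prop} (h : ∀ b, IsDef L (R b)) :
    IsDef L fun v => ∀ b, R b v := by
  choose φ hφ using h
  exact ⟨Language.Formula.iInf φ, fun v => by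
    rw [Language.Formula.realize_iInf]
    exact forall_congr' fun b => hφ b v⟩

theorem forall_mem {ι : Type*} (l : List ι) {R : ι → (α → ℕ) → Prop} (h : ∀ i ∈ l, IsDef L (R i)) :
    IsDef L fun v => ∀ i ∈ l, R i v := by
  have := forall_finite (β := Fin l.length) (R := fun j => R l[j])
    fun j => h _ (List.getElem_mem _)
  exact this.of_iff fun v => by
    constructor
    · exact fun h j => h _ (List.getElem_mem _)
    · intro h i hi
      obtain ⟨j, hj, rfl⟩ := List.getElem_of_mem hi
      exact h ⟨j, hj⟩

theorem exists_tuple [Finite β] {R : (α → ℕ) → (β → ℕ) → Prop}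
    (h : IsDef L fun v : α ⊕ β → ℕ => R (v ∘ Sum.inl) (v ∘ Sum.inr)) :
    IsDef L fun v => ∃ w, R v w := by
  obtain ⟨φ, hφ⟩ := h
  exact ⟨φ.iExs β, fun v => by
    rw [Language.Formula.realize_iExs]
    exact exists_congr fun w => (hφ _).trans (by simp)⟩

theorem exists_nat {R : (α → ℕ) → ℕ → Prop}
    (h : IsDef L fun v : α ⊕ Unit → ℕ => R (v ∘ Sum.inl) (v (Sum.inr ()))) :
    IsDef L fun v => ∃ y, R v y :=
  (exists_tuple (R := fun v w => R v (w ())) h).of_iff fun _ =>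
    ⟨fun ⟨y, hy⟩ => ⟨fun _ => y, hy⟩, fun ⟨w, hw⟩ => ⟨w (), hw⟩⟩

theorem forall_nat {R : (α → ℕ) → ℕ → Prop}
    (h : IsDef L fun v : α ⊕ Unit → ℕ => R (v ∘ Sum.inl) (v (Sum.inr ()))) :
    IsDef L fun v => ∀ y, R v y :=
  (exists_nat (R := fun v y => ¬ R v y) h.not).not.of_iff fun v => by simp

theorem subst [Finite β] {R : (β → ℕ) → Prop} (h : IsDef L R) {g : β → (α → ℕ) → ℕ}
    (hg : ∀ b, IsDefFun L (g b)) : IsDef L fun v => R fun b => g b v := by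
  refine (exists_tuple (β := β) (R := fun v w => (∀ b, g b v = w b) ∧ R w) ?_).of_iff fun v => ?_
  · refine (forall_finite fun b => ?_).and (h.relabel Sum.inr)
    exact (hg b).relabel (Sum.elim Sum.inl fun _ => Sum.inr b)
  · constructor
    · exact fun h => ⟨_, fun _ => rfl, h⟩
    · rintro ⟨w, hw, h⟩
      rwa [show (fun b => g b v) = w from funext hw]

theorem lhom {L₀ : FirstOrder.Language} [L₀.Structure ℕ] (ι : L₀ →ᴸ L) [ι.IsExpansionOn ℕ]
    {R : (α → ℕ) → Prop} (h : IsDef L₀ R) : IsDef L R := by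
  obtain ⟨φ, hφ⟩ := h
  exact ⟨ι.onFormula φ, fun v => by rw [Language.LHom.realize_onFormula, hφ]⟩

theorem eq_terms (t₁ t₂ : L.Term α) : IsDef L fun v => t₁.realize v = t₂.realize v :=
  ⟨t₁.equal t₂, fun _ => Language.Formula.realize_equal⟩

end IsDef

namespace IsDefFun

theorem term (t : L.Term α) : IsDefFun L fun v => t.realize v :=
  (IsDef.eq_terms (t.relabel Sum.inl) (Language.Term.var (Sum.inr ()))).of_iff fun v => by
    simp

theorem var (a : α) : IsDefFun L fun v => v a := term (Language.Term.var a)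

theorem comp [Finite β] {f : (β → ℕ) → ℕ} (hf : IsDefFun L f) {g : β → (α → ℕ) → ℕ}
    (hg : ∀ b, IsDefFun L (g b)) : IsDefFun L fun v => f fun b => g b v := by
  refine (IsDef.subst (β := β ⊕ Unit) hf
    (g := Sum.elim (fun b v => g b (v ∘ Sum.inl)) fun _ v => v (Sum.inr ())) ?_).of_iff fun v => ?_
  · rintro (b | b)
    · exact (hg b).relabel (Sum.map Sum.inl id)
    · exact var _
  · exact Iff.rfl

theorem comp₂ {f : ℕ → ℕ → ℕ} (hf : IsDefFun L fun v : Fin 2 → ℕ => f (v 0) (v 1))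
    {g g' : (α → ℕ) → ℕ} (hg : IsDefFun L g) (hg' : IsDefFun L g') :
    IsDefFun L fun v => f (g v) (g' v) :=
  comp hf (g := ![g, g']) fun b => by
    fin_cases b
    · exact hg
    · exact hg'

theorem eq {f g : (α → ℕ) → ℕ} (hf : IsDefFun L f) (hg : IsDefFun L g) :
    IsDef L fun v => f v = g v :=
  (IsDef.subst (β := Fin 2) (R := fun w => w 0 = w 1)
    (IsDef.eq_terms (Language.Term.var 0) (Language.Term.var 1)) (g := ![f, g]) fun b => by
      fin_cases b
      · exact hf
      · exact hg)

end IsDefFun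

end Definability

section Arith

variable {α : Type}

theorem IsDefFun.zero : IsDefFun arith fun _ : α → ℕ => 0 :=
  IsDefFun.term (L := arith) (Language.Term.func (L := arith) (l := 0) ArithFunc.zero ![])

theorem IsDefFun.one : IsDefFun arith fun _ : α → ℕ => 1 :=
  IsDefFun.term (L := arith) (Language.Term.func (L := arith) (l := 0) ArithFunc.one ![])

theorem IsDefFun.add {f g : (α → ℕ) → ℕ} (hf : IsDefFun arith f) (hg : IsDefFun arith g) :
    IsDefFun arith fun v => f v + g v :=
  IsDefFun.comp₂ (f := fun x y => x + y)
    (IsDefFun.term (L := arith) (Language.Term.func (L := arith) (l := 2) ArithFunc.add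
      ![Language.Term.var 0, Language.Term.var 1])) hf hg

theorem IsDefFun.mul {f g : (α → ℕ) → ℕ} (hf : IsDefFun arith f) (hg : IsDefFun arith g) :
    IsDefFun arith fun v => f v * g v :=
  IsDefFun.comp₂ (f := fun x y => x * y)
    (IsDefFun.term (L := arith) (Language.Term.func (L := arith) (l := 2) ArithFunc.mul
      ![Language.Term.var 0, Language.Term.var 1])) hf hg

theorem IsDef.lt {f g : (α → ℕ) → ℕ} (hf : IsDefFun arith f) (hg : IsDefFun arith g) :
    IsDef arith fun v => f v < g v := by
  refine (IsDef.exists_nat (R := fun v y => f v + 1 + y = g v) ?_).of_iff fun v => ?_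
  · exact IsDefFun.eq (IsDefFun.add (IsDefFun.add (hf.relabel (Sum.map Sum.inl id)) IsDefFun.one)
      (IsDefFun.var _)) (hg.relabel (Sum.map Sum.inl id))
  · rw [Nat.lt_iff_add_one_le, le_iff_exists_add]
    exact exists_congr fun c => eq_comm

theorem IsDefFun.mod : IsDefFun arith fun v : Fin 2 → ℕ => v 0 % (v 1 + 1) := by
  refine IsDef.of_iff (R := fun v : Fin 2 ⊕ Unit → ℕ => v (Sum.inr ()) < v (Sum.inl 1) + 1 ∧
    ∃ q, q * (v (Sum.inl 1) + 1) + v (Sum.inr ()) = v (Sum.inl 0)) ?_ ?_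
  · refine (IsDef.lt (IsDefFun.var _) (IsDefFun.add (IsDefFun.var _) IsDefFun.one)).and
      (IsDef.exists_nat ?_)
    exact IsDefFun.eq (IsDefFun.add (IsDefFun.mul (IsDefFun.var _)
      (IsDefFun.add (IsDefFun.var (Sum.inl (Sum.inl 1))) IsDefFun.one))
        (IsDefFun.var (Sum.inl (Sum.inr ())))) (IsDefFun.var (Sum.inl (Sum.inl 0)))
  · intro v
    simp only [Function.comp]
    constructor
    · intro h
      rw [← h]
      exact ⟨Nat.mod_lt _ (Nat.succ_pos _), _, Nat.div_add_mod' _ _⟩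
    · rintro ⟨h1, q, h2⟩
      rw [← h2, Nat.add_comm, Nat.add_mul_mod_self_right, Nat.mod_eq_of_lt h1]

/-- Gödel's function, with the two components of its first argument separated. -/
def godelBeta (a b i : ℕ) : ℕ := a % ((i + 1) * b + 1)

theorem exists_godelBeta (f : ℕ → ℕ) (n : ℕ) : ∃ a b, ∀ i ≤ n, godelBeta a b i = f i := by
  let l := (List.range (n + 1)).map f
  refine ⟨(Nat.unbeta l).unpair.1, (Nat.unbeta l).unpair.2, fun i hi => ?_⟩
  have := Nat.beta_unbeta_coe l ⟨i, by simp [l]; omega⟩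
  simpa [Nat.beta, godelBeta, l] using this

theorem IsDefFun.godelBeta {f g k : (α → ℕ) → ℕ} (hf : IsDefFun arith f) (hg : IsDefFun arith g)
    (hk : IsDefFun arith k) : IsDefFun arith fun v => godelBeta (f v) (g v) (k v) :=
  IsDefFun.comp₂ (f := fun x y => x % (y + 1)) IsDefFun.mod hf
    (IsDefFun.mul (IsDefFun.add hk IsDefFun.one) hg)

theorem IsDefFun.of_primrec' {n : ℕ} {f : List.Vector ℕ n → ℕ} (hf : Nat.Primrec' f) :
    IsDefFun arith fun v : Fin n → ℕ => f (List.Vector.ofFn v) := by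
  induction hf with
  | zero => exact IsDefFun.zero
  | succ =>
    simp only [List.Vector.head_ofFn]
    exact IsDefFun.add (IsDefFun.var _) IsDefFun.one
  | get i =>
    simp only [List.Vector.get_ofFn]
    exact IsDefFun.var i
  | comp g _ _ hf hg => exact IsDefFun.comp hf hg
  | @prec n f g _ _ hf hg =>
    simp only [List.Vector.head_ofFn, List.Vector.tail_ofFn]
    have hg' : ∀ {γ : Type} {y z : (γ → ℕ) → ℕ} {w : Fin n → (γ → ℕ) → ℕ}, IsDefFun arith y →
        IsDefFun arith z → (∀ i, IsDefFun arith (w i)) →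
        IsDefFun arith fun v => g (y v ::ᵥ z v ::ᵥ List.Vector.ofFn fun i => w i v) := by
      intro γ y z w hy hz hw
      refine IsDef.of_iff (IsDefFun.comp hg (g := Fin.cons y (Fin.cons z w)) ?_) fun v => ?_
      · intro b
        refine Fin.cases ?_ (fun b => ?_) b
        · exact hy
        · refine Fin.cases ?_ (fun b => ?_) b
          · exact hz
          · exact hw b
      · exact Iff.rfl
    have key : ∀ (v : Fin n → ℕ) (m y : ℕ),
        (Nat.rec (f (List.Vector.ofFn v))
          (fun y IH => g (y ::ᵥ IH ::ᵥ List.Vector.ofFn v)) m : ℕ) = y ↔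
        ∃ a b, NWGame.godelBeta a b 0 = f (List.Vector.ofFn v) ∧
          (∀ i, i < m → NWGame.godelBeta a b (i + 1) =
            g (i ::ᵥ NWGame.godelBeta a b i ::ᵥ List.Vector.ofFn v)) ∧
          NWGame.godelBeta a b m = y := by
      intro v m y
      constructor
      · intro h
        obtain ⟨a, b, hab⟩ := exists_godelBeta (fun m => (Nat.rec (f (List.Vector.ofFn v))
          (fun y IH => g (y ::ᵥ IH ::ᵥ List.Vector.ofFn v)) m : ℕ)) m
        refine ⟨a, b, hab 0 (Nat.zero_le _), fun i hi => ?_, (hab m le_rfl).trans h⟩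
        rw [hab _ hi, hab _ hi.le]
      · rintro ⟨a, b, h0, hs, hm⟩
        rw [← hm]
        have : ∀ i ≤ m, (Nat.rec (f (List.Vector.ofFn v))
            (fun y IH => g (y ::ᵥ IH ::ᵥ List.Vector.ofFn v)) i : ℕ) =
            NWGame.godelBeta a b i := by
          intro i
          induction i with
          | zero => intro _; exact h0.symm
          | succ i ih =>
            intro hi
            rw [hs i hi, ← ih (Nat.le_of_succ_le hi)]
        exact this m le_rfl
    refine IsDef.of_iff ?_ fun v => key _ _ _
    refine IsDef.exists_nat (IsDef.exists_nat (IsDef.and ?_ (IsDef.and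
      (IsDef.forall_nat (IsDef.imp ?_ ?_)) ?_)))
    · exact IsDefFun.eq (IsDefFun.godelBeta (IsDefFun.var (Sum.inl (Sum.inr ())))
        (IsDefFun.var (Sum.inr ())) IsDefFun.zero)
        (IsDefFun.comp hf (g := fun b v => v (Sum.inl (Sum.inl (Sum.inl b.succ))))
          fun b => IsDefFun.var _)
    · exact IsDef.lt (IsDefFun.var (Sum.inr ())) (IsDefFun.var
        (Sum.inl (Sum.inl (Sum.inl (Sum.inl 0)))))
    · refine IsDefFun.eq (IsDefFun.godelBeta (IsDefFun.var (Sum.inl (Sum.inl (Sum.inr ()))))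
        (IsDefFun.var (Sum.inl (Sum.inr ()))) (IsDefFun.add (IsDefFun.var (Sum.inr ()))
          IsDefFun.one)) ?_
      exact hg' (w := fun b v => v (Sum.inl (Sum.inl (Sum.inl (Sum.inl b.succ)))))
        (IsDefFun.var (Sum.inr ()))
        (IsDefFun.godelBeta (IsDefFun.var (Sum.inl (Sum.inl (Sum.inr ()))))
          (IsDefFun.var (Sum.inl (Sum.inr ()))) (IsDefFun.var (Sum.inr ())))
        fun b => IsDefFun.var _
    · exact IsDefFun.eq (IsDefFun.godelBeta (IsDefFun.var (Sum.inl (Sum.inr ())))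
        (IsDefFun.var (Sum.inr ())) (IsDefFun.var (Sum.inl (Sum.inl (Sum.inl 0)))))
        (IsDefFun.var (Sum.inl (Sum.inl (Sum.inr ()))))

/-- Primitive recursive relations are definable. -/
theorem IsDef.of_primrecPred {L : FirstOrder.Language} [L.Structure ℕ] (ι : arith →ᴸ L)
    [ι.IsExpansionOn ℕ] {k : ℕ} {R : (Fin k → ℕ) → Prop} (hR : PrimrecPred R) : IsDef L R := by
  classical
  have h1 : Primrec fun v : List.Vector ℕ k => if R v.get then 1 else 0 :=
    Primrec.ite (hR.comp Primrec.vector_get') (Primrec.const 1) (Primrec.const 0)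
  have h2 := IsDefFun.of_primrec' (Nat.Primrec'.of_prim h1)
  refine IsDef.lhom ι ((h2.eq IsDefFun.one).of_iff fun v => ?_)
  have : (List.Vector.ofFn v).get = v := funext fun i => List.Vector.get_ofFn v i
  rw [this]
  split_ifs with h <;> simp [h]

end Arith

end NWGame

namespace NWGame

/-! ### Polynomial time functions and games are primitive recursive -/

section Primrec

variable {α β σ : Type*} [Primcodable α] [Primcodable β] [Primcodable σ]

theorem primrec_pi {n : ℕ} {f : α → Fin n → σ} (h : ∀ i, Primrec fun a => f a i) : Primrec f :=
  Primrec.fin_curry.2 (Primrec₂.swap (f := fun i a => f a i) (Primrec.fin_curry₁.2 h))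

theorem primrec_apply {n : ℕ} (i : Fin n) : Primrec fun f : Fin n → σ => f i :=
  Primrec.fin_app.comp Primrec.id (Primrec.const i)

theorem primrec_pow : Primrec₂ fun a b : ℕ => a ^ b := by
  refine (Primrec.nat_rec (f := fun _ : ℕ => 1) (g := fun a p => p.2 * a) (Primrec.const 1)
    (Primrec.nat_mul.comp (Primrec.snd.comp Primrec.snd) Primrec.fst)).of_eq fun a b => ?_
  induction b with
  | zero => rfl
  | succ b ih => rw [pow_succ, ← ih]

theorem primrec_testBit : Primrec₂ Nat.testBit := by
  refine (Primrec.ite (c := fun p : ℕ × ℕ => p.1 / 2 ^ p.2 % 2 = 1)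
    (PrimrecRel.comp Primrec.eq (Primrec.nat_mod.comp (Primrec.nat_div.comp Primrec.fst
    (primrec_pow.comp (Primrec.const 2) Primrec.snd)) (Primrec.const 2)) (Primrec.const 1))
    (Primrec.const true) (Primrec.const false)).of_eq fun p => ?_
  rw [Nat.testBit_eq_decide_div_mod_eq]
  split_ifs with h <;> simp [h]

theorem primrec_eval (P : Polynomial ℕ) : Primrec fun n => P.eval n := by
  induction P using Polynomial.induction_on' with
  | add p q hp hq =>
    simp only [Polynomial.eval_add]
    exact Primrec.nat_add.comp hp hq
  | monomial k a =>
    simp only [Polynomial.eval_monomial]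
    exact Primrec.nat_mul.comp (Primrec.const a) (primrec_pow.comp Primrec.id (Primrec.const k))

end Primrec

theorem StackMachine.primrec_view (T : StackMachine) : Primrec T.view := by
  refine Primrec.pair Primrec.fst (primrec_pi fun k => primrec_pi fun j => ?_)
  exact Primrec.list_getElem?.comp ((primrec_apply k).comp Primrec.snd) (Primrec.const _)

theorem StackMachine.primrec_step (T : StackMachine) : Primrec T.step := by
  have h1 : Primrec fun c : T.Config => T.trans (T.view c).1 (T.view c).2 :=
    (Primrec.dom_finite fun p : Fin T.states × (Fin T.tapes → Fin T.depth → Option (Fin T.symbols)) =>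
      T.trans p.1 p.2).comp T.primrec_view
  refine Primrec.pair (Primrec.fst.comp h1) (primrec_pi fun k => ?_)
  exact Primrec.list_append.comp ((primrec_apply k).comp (Primrec.snd.comp h1))
    (Primrec.list_drop.comp (Primrec.const _) ((primrec_apply k).comp Primrec.snd))

theorem PolyTime.primrec {f : List Bool → List Bool} (hf : PolyTime f) : Primrec f := by
  obtain ⟨T, q, k₀, k₁, enc, dec, time, h⟩ := hf.exists_stackMachine
  refine Primrec.of_eq (f := fun x : List Bool =>
    (((T.step)^[time.eval x.length] (T.initial q k₀ (x.map enc))).2 k₁).map dec) ?_ h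
  refine Primrec.list_map ((primrec_apply k₁).comp (Primrec.snd.comp (Primrec.nat_iterate
    ((primrec_eval time).comp Primrec.list_length) (Primrec.pair (Primrec.const q)
    (primrec_pi fun k => ?_)) (T.primrec_step.comp Primrec.snd)))) ((Primrec.dom_finite dec).comp Primrec.snd)
  split_ifs
  · exact Primrec.list_map Primrec.id ((Primrec.dom_finite enc).comp Primrec.snd)
  · exact Primrec.const []

/-- All strings of length `n`. -/
def allStrings : ℕ → List (List Bool)
  | 0 => [List.nil]
  | n + 1 => (allStrings n).flatMap fun s => [true :: s, false :: s]

theorem mem_allStrings (s : List Bool) : s ∈ allStrings s.length := by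
  induction s with
  | nil => simp [allStrings]
  | cons x s ih =>
    simp only [List.length_cons, allStrings, List.mem_flatMap]
    exact ⟨s, ih, by cases x <;> simp⟩

theorem primrec_allStrings : Primrec allStrings := by
  refine (Primrec.nat_rec₁ (f := fun _ (l : List (List Bool)) =>
    l.flatMap fun s => [true :: s, false :: s]) [List.nil] ?_).of_eq fun n => ?_
  · refine Primrec.list_flatMap Primrec.snd ?_
    exact Primrec.list_cons.comp (Primrec.list_cons.comp (Primrec.const true) Primrec.snd)
      (Primrec.list_cons.comp (Primrec.list_cons.comp (Primrec.const false) Primrec.snd)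
        (Primrec.const []))
  · induction n with
    | zero => rfl
    | succ n ih => simp only [allStrings, ← ih]

theorem length_symm {h : Equiv.Perm (List Bool)} (hlen : ∀ v, (h v).length = v.length)
    (u : List Bool) : (h.symm u).length = u.length := by
  conv_rhs => rw [← h.apply_symm_apply u, hlen]

theorem primrec_symm {h : Equiv.Perm (List Bool)} (hlen : ∀ v, (h v).length = v.length)
    (hh : Primrec h) : Primrec h.symm := by
  refine Primrec.of_eq (f := fun u => ((allStrings u.length).filterMap fun v =>
    if h v = u then some v else none).headI) ?_ fun u => ?_
  · refine Primrec.list_headI.comp (Primrec.listFilterMap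
      (primrec_allStrings.comp Primrec.list_length) ?_)
    exact Primrec.ite (PrimrecRel.comp Primrec.eq (hh.comp Primrec.snd) Primrec.fst)
      (Primrec.option_some.comp Primrec.snd) (Primrec.const none)
  · have h1 : h.symm u ∈ (allStrings u.length).filterMap fun v =>
        if h v = u then some v else none := by
      rw [List.mem_filterMap]
      exact ⟨h.symm u, length_symm hlen u ▸ mem_allStrings _, by simp⟩
    cases h2 : (allStrings u.length).filterMap fun v => if h v = u then some v else none with
    | nil => rw [h2] at h1; cases h1
    | cons w l =>
      have h3 : w ∈ (allStrings u.length).filterMap fun v => if h v = u then some v else none := by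
        rw [h2]; simp
      rw [List.mem_filterMap] at h3
      obtain ⟨w', _, hw⟩ := h3
      split_ifs at hw with h4
      · simp only [Option.some.injEq] at hw
        subst hw
        exact (h.symm_apply_eq.2 h4.symm).symm

section Game

variable {α : Type*} [Primcodable α]

theorem primrec_bits : Primrec₂ bits :=
  Primrec.list_map (Primrec.list_range.comp Primrec.fst)
    (primrec_testBit.comp (Primrec.snd.comp Primrec.fst) Primrec.snd)

theorem primrec_ofBits : Primrec ofBits := by
  refine (Primrec.list_foldr (f := id) (g := fun _ => 0)
    (h := fun _ (p : Bool × ℕ) => bif p.1 then 2 * p.2 + 1 else 2 * p.2) Primrec.id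
    (Primrec.const 0) ?_).of_eq fun s => ?_
  · exact Primrec.cond (Primrec.fst.comp Primrec.snd)
      (Primrec.nat_double_succ.comp (Primrec.snd.comp Primrec.snd))
      (Primrec.nat_double.comp (Primrec.snd.comp Primrec.snd))
  · rfl

theorem primrec_encodeTuple : Primrec encodeTuple := by
  refine Primrec.list_flatMap Primrec.id (Primrec.list_append.comp
    (Primrec.list_flatMap Primrec.snd ?_) (Primrec.const _))
  exact Primrec.list_cons.comp (Primrec.const true)
    (Primrec.list_cons.comp Primrec.snd (Primrec.const []))

theorem restrict_eq_filterMap (n J i a : ℕ) : restrict n J i a =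
    (List.range n).filterMap fun j => bif J.testBit (i * n + j) then some (a.testBit j) else none := by
  unfold restrict
  induction List.range n with
  | nil => rfl
  | cons j l ih =>
    cases h : J.testBit (i * n + j) <;> simp [h, ih]

theorem primrec_restrict {n J i a : α → ℕ} (hn : Primrec n) (hJ : Primrec J) (hi : Primrec i)
    (ha : Primrec a) : Primrec fun x => restrict (n x) (J x) (i x) (a x) := by
  simp only [restrict_eq_filterMap]
  refine Primrec.listFilterMap (Primrec.list_range.comp hn) (Primrec.cond ?_ ?_ ?_)
  · exact primrec_testBit.comp (hJ.comp Primrec.fst) (Primrec.nat_add.comp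
      (Primrec.nat_mul.comp (hi.comp Primrec.fst) (hn.comp Primrec.fst)) Primrec.snd)
  · exact Primrec.option_some.comp (primrec_testBit.comp (ha.comp Primrec.fst) Primrec.snd)
  · exact Primrec.const none

theorem primrec_play {h : Equiv.Perm (List Bool)} (hsymm : Primrec h.symm) {B : List Bool → Bool}
    (hB : Primrec B) {n J b a : α → ℕ} (hn : Primrec n) (hJ : Primrec J) (hb : Primrec b)
    (ha : Primrec a) {inp : α → List (List Bool)} (hinp : Primrec inp)
    {out : List Bool → List Bool} (hout : Primrec out) (moves : List (List Bool → List Bool))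
    (hmoves : ∀ S ∈ moves, Primrec S) {ys : α → List (List Bool)} (hys : Primrec ys) :
    Primrec fun x => play h B (n x) (J x) (b x) (a x) (inp x) out moves (ys x) := by
  have hfin : ∀ {ys : α → List (List Bool)}, Primrec ys →
      Primrec fun x => some (ofBits (out (encodeTuple (inp x ++ ys x)))) := fun hys =>
    Primrec.option_some.comp (primrec_ofBits.comp (hout.comp (primrec_encodeTuple.comp
      (Primrec.list_append.comp hinp hys))))
  induction moves generalizing ys with
  | nil => exact hfin hys
  | cons S moves ih =>
    have hi : Primrec fun x => ofBits (S (encodeTuple (inp x ++ ys x))) :=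
      primrec_ofBits.comp ((hmoves S (by simp)).comp (primrec_encodeTuple.comp
        (Primrec.list_append.comp hinp hys)))
    have hv : Primrec fun x => h.symm (restrict (n x) (J x)
        (ofBits (S (encodeTuple (inp x ++ ys x)))) (a x)) :=
      hsymm.comp (primrec_restrict hn hJ hi ha)
    refine Primrec.ite (PrimrecRel.comp Primrec.nat_lt hi (Primrec.succ.comp hn))
      (Primrec.ite (PrimrecRel.comp Primrec.eq (hB.comp hv) (primrec_testBit.comp hb hi))
        (ih (fun S hS => hmoves S (by simp [hS])) ?_) (Primrec.const none)) (hfin hys)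
    exact Primrec.list_append.comp hys (Primrec.list_cons.comp hv (Primrec.const []))

theorem Student.primrec_result (S : Student) {h : Equiv.Perm (List Bool)} (hsymm : Primrec h.symm)
    {B : List Bool → Bool} (hB : Primrec B) {n J b p w a : α → ℕ} (hn : Primrec n)
    (hJ : Primrec J) (hb : Primrec b) (hp : Primrec p) (hw : Primrec w) (ha : Primrec a) :
    Primrec fun x => S.result h B (n x) (J x) (b x) (p x) (w x) (a x) := by
  refine primrec_play hsymm hB hn hJ hb ha ?_ S.polyTime_out.primrec S.moves
    (fun T hT => (S.polyTime_moves T hT).primrec) (Primrec.const [])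
  have hs := Primrec.succ.comp hn
  exact Primrec.list_cons.comp (primrec_bits.comp hn ha) (Primrec.list_cons.comp
    (primrec_bits.comp (Primrec.nat_mul.comp hs hn) hJ) (Primrec.list_cons.comp
    (primrec_bits.comp hs hb) (Primrec.list_cons.comp (primrec_bits.comp hp hw)
    (Primrec.const []))))

end Game

/-! ### Transfer between the standard model and `M` -/

/-- The relation `R` with its `L`-definition interpreted in `M`, for any set of variables. -/
def HoldsAt (L : FirstOrder.Language.{u, v}) (M : Type x) [L.Structure ℕ] [L.Structure M] {α : Type}
    (R : (α → ℕ) → Prop) (x : α → M) : Prop :=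
  ∃ φ : L.Formula α, (∀ v : α → ℕ, φ.Realize v ↔ R v) ∧ φ.Realize x

section Transfer

variable {L : FirstOrder.Language.{u, v}} [L.Structure ℕ] {M : Type x} [L.Structure M]
  {α β : Type}

theorem realize_of_forall_nat [Finite α] (hM : M ⊨ L.completeTheory ℕ) (φ : L.Formula α)
    (hφ : ∀ v : α → ℕ, φ.Realize v) (x : α → M) : φ.Realize x := by
  have h1 : ((φ.relabel (Sum.inr : α → Empty ⊕ α)).iAlls α : L.Sentence) ∈ L.completeTheory ℕ := by
    rw [Language.mem_completeTheory, Language.Sentence.Realize, Language.Formula.realize_iAlls]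
    intro v
    rw [Language.Formula.realize_relabel]
    exact hφ _
  have h2 := hM.realize_of_mem _ h1
  rw [Language.Sentence.Realize, Language.Formula.realize_iAlls] at h2
  have h3 := h2 x
  rwa [Language.Formula.realize_relabel] at h3

theorem HoldsAt.realize [Finite α] (hM : M ⊨ L.completeTheory ℕ) {R : (α → ℕ) → Prop} {x : α → M}
    (h : HoldsAt L M R x) {φ : L.Formula α} (hφ : ∀ v, R v → φ.Realize v) : φ.Realize x := by
  obtain ⟨ψ, hψ, hx⟩ := h
  have := realize_of_forall_nat hM (ψ.imp φ) (fun v => by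
    rw [Language.Formula.realize_imp, hψ]; exact hφ v) x
  exact Language.Formula.realize_imp.1 this hx

theorem HoldsAt.mono [Finite α] (hM : M ⊨ L.completeTheory ℕ) {R R' : (α → ℕ) → Prop} {x : α → M}
    (h : HoldsAt L M R x) (hR' : IsDef L R') (hRR' : ∀ v, R v → R' v) : HoldsAt L M R' x := by
  obtain ⟨φ, hφ⟩ := hR'
  exact ⟨φ, hφ, h.realize hM fun v hv => (hφ v).2 (hRR' v hv)⟩

theorem HoldsAt.and {R R' : (α → ℕ) → Prop} {x : α → M} (h : HoldsAt L M R x)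
    (h' : HoldsAt L M R' x) : HoldsAt L M (fun v => R v ∧ R' v) x := by
  obtain ⟨φ, hφ, hx⟩ := h
  obtain ⟨φ', hφ', hx'⟩ := h'
  exact ⟨φ ⊓ φ', fun v => by rw [Language.Formula.realize_inf, hφ, hφ'],
    Language.Formula.realize_inf.2 ⟨hx, hx'⟩⟩

theorem HoldsAt.relabel {R : (α → ℕ) → Prop} (g : α → β) {x : β → M} (h : HoldsAt L M R (x ∘ g)) :
    HoldsAt L M (fun v => R (v ∘ g)) x := by
  obtain ⟨φ, hφ, hx⟩ := h
  exact ⟨φ.relabel g, fun v => by rw [Language.Formula.realize_relabel, hφ],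
    Language.Formula.realize_relabel.2 hx⟩

theorem HoldsAt.relabel' {R : (α → ℕ) → Prop} {y : α → M} (h : HoldsAt L M R y) (g : α → β)
    {x : β → M} (hy : x ∘ g = y) : HoldsAt L M (fun v => R (v ∘ g)) x :=
  HoldsAt.relabel g (hy ▸ h)

theorem HoldsAt.of_relabel [Finite β] (hM : M ⊨ L.completeTheory ℕ) {R : (α → ℕ) → Prop}
    (hR : IsDef L R) (g : α → β) {x : β → M} (h : HoldsAt L M (fun v => R (v ∘ g)) x) :
    HoldsAt L M R (x ∘ g) := by
  obtain ⟨φ, hφ⟩ := hR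
  exact ⟨φ, hφ, Language.Formula.realize_relabel.1 (h.realize hM (φ := φ.relabel g) fun v hv => by
    rw [Language.Formula.realize_relabel, hφ]; exact hv)⟩

theorem HoldsAt.of_relabel' [Finite β] (hM : M ⊨ L.completeTheory ℕ) {R : (α → ℕ) → Prop}
    {x : β → M} {y : α → M} {R' : (β → ℕ) → Prop} (h : HoldsAt L M R' x) (hR : IsDef L R)
    (g : α → β) (hy : x ∘ g = y) (hR' : ∀ v, R' v ↔ R (v ∘ g) := by intro v; exact Iff.rfl) :
    HoldsAt L M R y :=
  hy ▸ HoldsAt.of_relabel hM hR g (h.mono hM (hR.relabel g) fun v => (hR' v).1)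

theorem HoldsAt.ne [Finite α] (hM : M ⊨ L.completeTheory ℕ) {i j : α} {x : α → M}
    (h : HoldsAt L M (fun v => v i ≠ v j) x) : x i ≠ x j := by
  have := h.realize hM (φ := ((Language.Term.var i).equal (Language.Term.var j)).not)
    fun v hv => by
      rw [Language.Formula.realize_not, Language.Formula.realize_equal]
      exact hv
  rw [Language.Formula.realize_not, Language.Formula.realize_equal] at this
  exact this

theorem holdsAt_or_not (R : (α → ℕ) → Prop) (hR : IsDef L R) (x : α → M) :
    HoldsAt L M R x ∨ HoldsAt L M (fun v => ¬ R v) x := by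
  obtain ⟨φ, hφ⟩ := hR
  by_cases h : φ.Realize x
  · exact Or.inl ⟨φ, hφ, h⟩
  · exact Or.inr ⟨φ.not, fun v => by rw [Language.Formula.realize_not, hφ],
      Language.Formula.realize_not.2 h⟩

theorem HoldsAt.exists_tuple [Finite α] [Finite β] (hM : M ⊨ L.completeTheory ℕ)
    {R : (α → ℕ) → (β → ℕ) → Prop} {x : α → M} (h : HoldsAt L M (fun v => ∃ w, R v w) x)
    (hR : IsDef L fun v : α ⊕ β → ℕ => R (v ∘ Sum.inl) (v ∘ Sum.inr)) :
    ∃ y : β → M, HoldsAt L M (fun v : α ⊕ β → ℕ => R (v ∘ Sum.inl) (v ∘ Sum.inr)) (Sum.elim x y) := by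
  obtain ⟨φ, hφ⟩ := hR
  have := h.realize hM (φ := φ.iExs β) fun v ⟨w, hw⟩ => by
    rw [Language.Formula.realize_iExs]
    exact ⟨w, by rw [hφ]; simpa using hw⟩
  rw [Language.Formula.realize_iExs] at this
  exact this.imp fun y hy => ⟨φ, hφ, hy⟩

theorem HoldsAt.forall_tuple [Finite α] [Finite β] (hM : M ⊨ L.completeTheory ℕ)
    {R : (α → ℕ) → (β → ℕ) → Prop} {x : α → M} (h : HoldsAt L M (fun v => ∀ w, R v w) x)
    (hR : IsDef L fun v : α ⊕ β → ℕ => R (v ∘ Sum.inl) (v ∘ Sum.inr)) (y : β → M) :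
    HoldsAt L M (fun v : α ⊕ β → ℕ => R (v ∘ Sum.inl) (v ∘ Sum.inr)) (Sum.elim x y) := by
  obtain ⟨φ, hφ⟩ := hR
  have := h.realize hM (φ := φ.iAlls β) fun v hv => by
    rw [Language.Formula.realize_iAlls]
    exact fun w => by rw [hφ]; simpa using hv w
  rw [Language.Formula.realize_iAlls] at this
  exact ⟨φ, hφ, this y⟩

/-- Saturation for a family of definable relations, closed under finite conjunctions. -/
theorem IsAleph1Saturated.exists_holdsAt {k : ℕ} {I : Type*} (hM : M ⊨ L.completeTheory ℕ)
    (hsat : IsAleph1Saturated L M) (R : I → (Fin k → ℕ) → ℕ → Prop)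
    (hR : ∀ i, IsDef L fun v : Fin k ⊕ Unit → ℕ => R i (v ∘ Sum.inl) (v (Sum.inr ())))
    (x : Fin k → M)
    (hx : ∀ l : List I, HoldsAt L M (fun v => ∃ y, ∀ i ∈ l, R i v y) x) :
    ∃ y : M, ∀ i, HoldsAt L M (fun v : Fin k ⊕ Unit → ℕ => R i (v ∘ Sum.inl) (v (Sum.inr ())))
      (Sum.elim x fun _ => y) := by
  classical
  choose φ hφ using hR
  let A : Set M := Set.range x
  let θ : I → L[[A]].Formula (Fin 1) := fun i =>
    ((L.lhomWithConstants A).onFormula (φ i)).subst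
      (Sum.elim (fun j => (L.con (⟨x j, j, rfl⟩ : A)).term) fun _ => Language.Term.var 0)
  have hθ : ∀ i (y : M), (θ i).Realize ![y] ↔ (φ i).Realize (Sum.elim x fun _ => y) := by
    intro i y
    rw [Language.Formula.Realize, Language.BoundedFormula.realize_subst,
      ← Language.Formula.Realize, Language.LHom.realize_onFormula]
    have h1 : (fun a : Fin k ⊕ Unit => Language.Term.realize ![y]
        ((Sum.elim (fun j => (L.con (⟨x j, j, rfl⟩ : A)).term)
          fun _ => Language.Term.var 0 : Fin k ⊕ Unit → L[[A]].Term (Fin 1)) a)) =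
        Sum.elim x fun _ => y := by
      funext a
      rcases a with j | _
      · simp
      · rfl
    rw [h1]
  obtain ⟨y, hy⟩ := hsat A (Set.countable_range x) (Set.range θ) fun Γ₀ hΓ₀ => by
    have h1 : ∀ ψ ∈ Γ₀.toList, ∃ i, θ i = ψ := fun ψ hψ => hΓ₀ (Finset.mem_toList.1 hψ)
    obtain ⟨l, hl⟩ : ∃ l : List I, ∀ ψ ∈ Γ₀, ∃ i ∈ l, θ i = ψ := by
      refine ⟨Γ₀.toList.attach.map fun ψ => (h1 ψ.1 ψ.2).choose, fun ψ hψ => ?_⟩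
      refine ⟨_, List.mem_map.2 ⟨⟨ψ, Finset.mem_toList.2 hψ⟩, List.mem_attach _ _, rfl⟩, ?_⟩
      exact (h1 ψ (Finset.mem_toList.2 hψ)).choose_spec
    have h2 : HoldsAt L M (fun v => ∃ w : Unit → ℕ, ∀ i ∈ l, R i v (w ())) x := by
      obtain ⟨ψ, hψ, hx⟩ := hx l
      exact ⟨ψ, fun v => (hψ v).trans ⟨fun ⟨y, hy⟩ => ⟨fun _ => y, hy⟩, fun ⟨w, hw⟩ => ⟨w (), hw⟩⟩, hx⟩
    obtain ⟨y, hy⟩ := h2.exists_tuple (R := fun v w => ∀ i ∈ l, R i v (w ())) hM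
      (IsDef.forall_mem l fun i _ => ⟨φ i, hφ i⟩)
    refine ⟨y (), fun ψ hψ => ?_⟩
    obtain ⟨i, hi, rfl⟩ := hl ψ hψ
    exact (hθ i _).2 (hy.realize hM fun v hv => (hφ i v).2 (hv i hi))
  exact ⟨y, fun i => ⟨φ i, hφ i, (hθ i y).1 (hy _ ⟨i, rfl⟩)⟩⟩

end Transfer

end NWGame

namespace NWGame

/-! ### Boolean circuits over a set of available functions -/

/-- All functions in `G` can be obtained from the functions in `F` by a sequence of at most `s`
gates. -/
inductive Reach {X : Type} : Set (X → Bool) → ℕ → Set (X → Bool) → Prop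
  | done {F G : Set (X → Bool)} (s : ℕ) : G ⊆ F → Reach F s G
  | const {F G : Set (X → Bool)} {s : ℕ} (c : Bool) :
      Reach (insert (fun _ => c) F) s G → Reach F (s + 1) G
  | not {F G : Set (X → Bool)} {s : ℕ} {f : X → Bool} : f ∈ F →
      Reach (insert (fun x => !f x) F) s G → Reach F (s + 1) G
  | and {F G : Set (X → Bool)} {s : ℕ} {f g : X → Bool} : f ∈ F → g ∈ F →
      Reach (insert (fun x => f x && g x) F) s G → Reach F (s + 1) G
  | or {F G : Set (X → Bool)} {s : ℕ} {f g : X → Bool} : f ∈ F → g ∈ F →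
      Reach (insert (fun x => f x || g x) F) s G → Reach F (s + 1) G

namespace Reach

variable {X : Type} {F F' G G' K : Set (X → Bool)} {s t : ℕ} {f g : X → Bool}

theorem mono_left (h : Reach F s G) (hF : F ⊆ F') : Reach F' s G := by
  induction h generalizing F' with
  | done s h => exact .done s (h.trans hF)
  | const c _ ih => exact .const c (ih (Set.insert_subset_insert hF))
  | not hf _ ih => exact .not (hF hf) (ih (Set.insert_subset_insert hF))
  | and hf hg _ ih => exact .and (hF hf) (hF hg) (ih (Set.insert_subset_insert hF))
  | or hf hg _ ih => exact .or (hF hf) (hF hg) (ih (Set.insert_subset_insert hF))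

theorem mono_right (h : Reach F s G) (hG : G' ⊆ G) : Reach F s G' := by
  induction h with
  | done s h => exact .done s (hG.trans h)
  | const c _ ih => exact .const c (ih hG)
  | not hf _ ih => exact .not hf (ih hG)
  | and hf hg _ ih => exact .and hf hg (ih hG)
  | or hf hg _ ih => exact .or hf hg (ih hG)

theorem mono_size (h : Reach F s G) (hst : s ≤ t) : Reach F t G := by
  induction h generalizing t with
  | done s h => exact .done t h
  | const c _ ih =>
    obtain ⟨t, rfl⟩ := Nat.exists_eq_add_of_le' (Nat.one_le_of_lt hst)
    exact .const c (ih (Nat.le_of_succ_le_succ hst))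
  | not hf _ ih =>
    obtain ⟨t, rfl⟩ := Nat.exists_eq_add_of_le' (Nat.one_le_of_lt hst)
    exact .not hf (ih (Nat.le_of_succ_le_succ hst))
  | and hf hg _ ih =>
    obtain ⟨t, rfl⟩ := Nat.exists_eq_add_of_le' (Nat.one_le_of_lt hst)
    exact .and hf hg (ih (Nat.le_of_succ_le_succ hst))
  | or hf hg _ ih =>
    obtain ⟨t, rfl⟩ := Nat.exists_eq_add_of_le' (Nat.one_le_of_lt hst)
    exact .or hf hg (ih (Nat.le_of_succ_le_succ hst))

theorem keep (h : Reach F s G) : Reach F s (F ∪ G) := by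
  induction h with
  | done s h => exact .done s (Set.union_subset subset_rfl h)
  | const c _ ih =>
    exact .const c (ih.mono_right (Set.union_subset_union_left _ (Set.subset_insert _ _)))
  | not hf _ ih =>
    exact .not hf (ih.mono_right (Set.union_subset_union_left _ (Set.subset_insert _ _)))
  | and hf hg _ ih =>
    exact .and hf hg (ih.mono_right (Set.union_subset_union_left _ (Set.subset_insert _ _)))
  | or hf hg _ ih =>
    exact .or hf hg (ih.mono_right (Set.union_subset_union_left _ (Set.subset_insert _ _)))

theorem trans (h : Reach F s G) (h' : Reach G t K) : Reach F (s + t) K := by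
  induction h with
  | done s h => exact (h'.mono_left h).mono_size (Nat.le_add_left _ _)
  | const c _ ih => exact Nat.add_right_comm _ _ _ ▸ .const c (ih h')
  | not hf _ ih => exact Nat.add_right_comm _ _ _ ▸ .not hf (ih h')
  | and hf hg _ ih => exact Nat.add_right_comm _ _ _ ▸ .and hf hg (ih h')
  | or hf hg _ ih => exact Nat.add_right_comm _ _ _ ▸ .or hf hg (ih h')

theorem union (h : Reach F s G) (h' : Reach F t G') : Reach F (s + t) (G ∪ G') :=
  (h.keep.trans (h'.mono_left Set.subset_union_left).keep).mono_right
    (Set.union_subset_union_left _ Set.subset_union_right)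

theorem biUnion_finset {ι : Type*} (I : Finset ι) {G : ι → Set (X → Bool)}
    (h : ∀ i ∈ I, Reach F s (G i)) : Reach F (I.card * s) (⋃ i ∈ I, G i) := by
  classical
  induction I using Finset.induction_on with
  | empty => exact .done _ (by simp)
  | insert a I ha ih =>
    rw [Finset.card_insert_of_notMem ha, Finset.set_biUnion_insert, Nat.succ_mul, Nat.add_comm]
    exact (h a (by simp)).union (ih fun i hi => h i (by simp [hi]))

theorem iUnion_fintype {ι : Type*} [Fintype ι] {G : ι → Set (X → Bool)}
    (h : ∀ i, Reach F s (G i)) : Reach F (Fintype.card ι * s) (⋃ i, G i) :=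
  (biUnion_finset Finset.univ fun i _ => h i).mono_right (by simp)

theorem range_fintype {ι : Type*} [Fintype ι] {f : ι → X → Bool}
    (h : ∀ i, Reach F s {f i}) : Reach F (Fintype.card ι * s) (Set.range f) :=
  (iUnion_fintype h).mono_right (by rintro _ ⟨i, rfl⟩; simp)

theorem of_mem (hf : f ∈ F) : Reach F 0 {f} := .done 0 (by simpa using hf)

theorem constant (c : Bool) : Reach F 1 {fun _ => c} := .const c (.of_mem (by simp))

theorem gate_not (h : Reach F s {f}) : Reach F (s + 1) {fun x => !f x} :=
  h.trans (.not (Set.mem_singleton f) (.of_mem (by simp)))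

theorem gate_and (h : Reach F s {f}) (h' : Reach F t {g}) :
    Reach F (s + t + 1) {fun x => f x && g x} :=
  (h.union h').trans (.and (f := f) (g := g) (by simp) (by simp) (.of_mem (by simp)))

theorem gate_or (h : Reach F s {f}) (h' : Reach F t {g}) :
    Reach F (s + t + 1) {fun x => f x || g x} :=
  (h.union h').trans (.or (f := f) (g := g) (by simp) (by simp) (.of_mem (by simp)))

theorem any_list {ι : Type*} (l : List ι) {f : ι → X → Bool} (h : ∀ i ∈ l, Reach F s {f i}) :
    Reach F (l.length * (s + 1) + 1) {fun x => l.any fun i => f i x} := by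
  induction l with
  | nil => simpa using constant false
  | cons i l ih =>
    have := (h i (by simp)).gate_or (ih fun j hj => h j (by simp [hj]))
    simp only [List.any_cons, List.length_cons]
    exact this.mono_size (le_of_eq (by ring))

theorem all_list {ι : Type*} (l : List ι) {f : ι → X → Bool} (h : ∀ i ∈ l, Reach F s {f i}) :
    Reach F (l.length * (s + 1) + 1) {fun x => l.all fun i => f i x} := by
  induction l with
  | nil => simpa using constant true
  | cons i l ih =>
    have := (h i (by simp)).gate_and (ih fun j hj => h j (by simp [hj]))
    simp only [List.all_cons, List.length_cons]
    exact this.mono_size (le_of_eq (by ring))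

theorem exists_fintype {ι : Type*} [Fintype ι] {p : ι → X → Prop} [∀ i x, Decidable (p i x)]
    [∀ x, Decidable (∃ i, p i x)] (h : ∀ i, Reach F s {fun x => decide (p i x)}) :
    Reach F (Fintype.card ι * (s + 1) + 1) {fun x => decide (∃ i, p i x)} := by
  have := any_list (Finset.univ : Finset ι).toList (f := fun i x => decide (p i x)) fun i _ => h i
  rw [Finset.length_toList, Finset.card_univ] at this
  convert this using 3 with x
  rw [Bool.eq_iff_iff]
  simp

theorem forall_fintype {ι : Type*} [Fintype ι] {p : ι → X → Prop} [∀ i x, Decidable (p i x)]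
    [∀ x, Decidable (∀ i, p i x)] (h : ∀ i, Reach F s {fun x => decide (p i x)}) :
    Reach F (Fintype.card ι * (s + 1) + 1) {fun x => decide (∀ i, p i x)} := by
  have := all_list (Finset.univ : Finset ι).toList (f := fun i x => decide (p i x)) fun i _ => h i
  rw [Finset.length_toList, Finset.card_univ] at this
  convert this using 3 with x
  rw [Bool.eq_iff_iff]
  simp

theorem decide_and {p q : X → Prop} [DecidablePred p] [DecidablePred q]
    [DecidablePred fun x => p x ∧ q x] (h : Reach F s {fun x => decide (p x)})
    (h' : Reach F t {fun x => decide (q x)}) :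
    Reach F (s + t + 1) {fun x => decide (p x ∧ q x)} := by
  convert h.gate_and h' using 3 with x
  rw [Bool.eq_iff_iff]
  simp

theorem decide_not {p : X → Prop} [DecidablePred p]
    [DecidablePred fun x => ¬ p x] (h : Reach F s {fun x => decide (p x)}) :
    Reach F (s + 1) {fun x => decide (¬ p x)} := by
  convert h.gate_not using 3 with x
  rw [Bool.eq_iff_iff]
  simp

theorem decide_const (p : Prop) [Decidable p] : Reach F 1 {fun _ => decide p} := constant _

/-- A function of `d` of the available functions costs at most `5 * 2 ^ d` gates. -/
theorem of_dependsOn {ℓ : ℕ} {F : Set ((Fin ℓ → Bool) → Bool)} (hF : ∀ r : Fin ℓ, (fun u => u r) ∈ F)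
    (D : Finset (Fin ℓ)) (f : (Fin ℓ → Bool) → Bool)
    (hf : ∀ u u', (∀ r ∈ D, u r = u' r) → f u = f u') : Reach F (5 * 2 ^ D.card - 4) {f} := by
  classical
  induction D using Finset.induction_on generalizing f with
  | empty =>
    have : f = fun _ => f fun _ => false := funext fun u => hf _ _ (by simp)
    rw [this]
    exact (constant _).mono_size (by simp)
  | insert r D hr ih =>
    have h1 : ∀ c, Reach F (5 * 2 ^ D.card - 4) {fun u => f (Function.update u r c)} := fun c => by
      refine ih _ fun u u' h => hf _ _ fun r' hr' => ?_
      by_cases h2 : r' = r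
      · subst h2; simp
      · simp only [ne_eq, h2, not_false_eq_true, Function.update_of_ne]
        exact h r' (Finset.mem_of_mem_insert_of_ne hr' h2)
    have h2 := ((of_mem (hF r)).gate_and (h1 true)).gate_or
      ((of_mem (hF r)).gate_not.gate_and (h1 false))
    have h3 : f = fun u => (u r && f (Function.update u r true)) ||
        (!u r && f (Function.update u r false)) := by
      funext u
      cases h : u r
      · simp only [Bool.false_and, Bool.not_false, Bool.true_and, Bool.false_or]
        rw [← h, Function.update_eq_self]
      · simp only [Bool.true_and, Bool.not_true, Bool.false_and, Bool.or_false]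
        rw [← h, Function.update_eq_self]
    rw [h3]
    refine h2.mono_size ?_
    rw [Finset.card_insert_of_notMem hr, pow_succ]
    have := Nat.one_le_two_pow (n := D.card)
    omega

/-- The circuit given by a sequence of gates. -/
theorem exists_circuit {ℓ : ℕ} {F G : Set ((Fin ℓ → Bool) → Bool)} (h : Reach F s G)
    (ws : List ((Fin ℓ → Bool) → Bool)) (hF : ∀ f ∈ F, f ∈ ws) :
    ∃ (C : Circuit) (ws' : List ((Fin ℓ → Bool) → Bool)), C.length ≤ s ∧
      (∀ u, C.foldl (fun ws g => ws ++ [g.eval ws]) (ws.map fun f => f u) = ws'.map fun f => f u) ∧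
      ∀ f ∈ G, f ∈ ws' := by
  have hget : ∀ {ws : List ((Fin ℓ → Bool) → Bool)} {f}, f ∈ ws →
      ∃ i, ∀ u, (ws.map fun f => f u).getD i false = f u := by
    intro ws f hf
    obtain ⟨i, hi, rfl⟩ := List.getElem_of_mem hf
    exact ⟨i, fun u => by simp [List.getD, hi]⟩
  have hstep : ∀ {s : ℕ} {F G : Set ((Fin ℓ → Bool) → Bool)} (ws : List ((Fin ℓ → Bool) → Bool))
      (g : Gate) (k : (Fin ℓ → Bool) → Bool), (∀ f ∈ F, f ∈ ws) →
      (∀ u, g.eval (ws.map fun f => f u) = k u) →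
      (∀ ws : List ((Fin ℓ → Bool) → Bool), (∀ f ∈ insert k F, f ∈ ws) →
        ∃ (C : Circuit) (ws' : List ((Fin ℓ → Bool) → Bool)), C.length ≤ s ∧
          (∀ u, C.foldl (fun ws g => ws ++ [g.eval ws]) (ws.map fun f => f u) =
            ws'.map fun f => f u) ∧ ∀ f ∈ G, f ∈ ws') →
        ∃ (C : Circuit) (ws' : List ((Fin ℓ → Bool) → Bool)), C.length ≤ s + 1 ∧
          (∀ u, C.foldl (fun ws g => ws ++ [g.eval ws]) (ws.map fun f => f u) =
            ws'.map fun f => f u) ∧ ∀ f ∈ G, f ∈ ws' := by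
    intro s F G ws g k hF hg ih
    obtain ⟨C, ws', h1, h2, h3⟩ := ih (ws ++ [k]) (by
      rintro f (rfl | hf)
      · simp
      · simp [hF f hf])
    refine ⟨g :: C, ws', by simpa using h1, fun u => ?_, h3⟩
    rw [List.foldl_cons, hg, ← h2]
    simp
  induction h generalizing ws with
  | done s h => exact ⟨[], ws, Nat.zero_le _, fun u => rfl, fun f hf => hF f (h hf)⟩
  | const c _ ih => exact hstep ws (.const c) _ hF (fun u => rfl) ih
  | not hf _ ih =>
    obtain ⟨i, hi⟩ := hget (hF _ hf)
    exact hstep ws (.not i) _ hF (fun u => by simp only [Gate.eval, hi]) ih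
  | and hf hg _ ih =>
    obtain ⟨i, hi⟩ := hget (hF _ hf)
    obtain ⟨j, hj⟩ := hget (hF _ hg)
    exact hstep ws (.and i j) _ hF (fun u => by simp only [Gate.eval, hi, hj]) ih
  | or hf hg _ ih =>
    obtain ⟨i, hi⟩ := hget (hF _ hf)
    obtain ⟨j, hj⟩ := hget (hF _ hg)
    exact hstep ws (.or i j) _ hF (fun u => by simp only [Gate.eval, hi, hj]) ih

theorem exists_circuit_eval {ℓ : ℕ} {f : (Fin ℓ → Bool) → Bool}
    (h : Reach (Set.range fun (r : Fin ℓ) u => u r) s {f}) :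
    ∃ C : Circuit, C.length ≤ s + 1 ∧ ∀ u, C.eval (List.ofFn u) = f u := by
  obtain ⟨C, ws, h1, h2, h3⟩ := h.exists_circuit (List.ofFn fun (r : Fin ℓ) u => u r) (by
    rintro _ ⟨r, rfl⟩
    exact List.mem_ofFn.2 ⟨r, rfl⟩)
  obtain ⟨i, hi, hf⟩ := List.getElem_of_mem (h3 f rfl)
  refine ⟨C ++ [.or i i], by simpa using h1, fun u => ?_⟩
  have h4 : List.ofFn u = (List.ofFn fun (r : Fin ℓ) (u : Fin ℓ → Bool) => u r).map fun f => f u := by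
    rw [List.map_ofFn]
    rfl
  unfold Circuit.eval
  rw [List.foldl_append, h4, h2, List.foldl_cons, List.foldl_nil]
  simp [Gate.eval, List.getD, hi, hf]

end Reach

/-! ### Circuits for polynomial time functions -/

section Machine

variable {X : Type}

/-- The functions describing the state and the `N` topmost symbols of every stack of a configuration
depending on `x`. -/
def configBits (T : StackMachine) (N : ℕ) (c : X → T.Config) : Set (X → Bool) :=
  Set.range (fun (q : Fin T.states) x => decide ((c x).1 = q)) ∪
  Set.range (fun (i : Fin T.tapes × Fin N × Option (Fin T.symbols)) x =>
    decide (((c x).2 i.1)[(i.2.1 : ℕ)]? = i.2.2))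

theorem reach_configBits (T : StackMachine) {N s : ℕ} {F : Set (X → Bool)} {c : X → T.Config}
    (h1 : ∀ q, Reach F s {fun x => decide ((c x).1 = q)})
    (h2 : ∀ k, ∀ j < N, ∀ o, Reach F s {fun x => decide (((c x).2 k)[j]? = o)}) :
    Reach F ((T.states + T.tapes * (T.symbols + 1)) * s * (N + 1)) (configBits T N c) := by
  refine ((Reach.range_fintype h1).union (Reach.range_fintype
    fun i : Fin T.tapes × Fin N × Option (Fin T.symbols) => h2 i.1 i.2.1 i.2.1.2 i.2.2)
    ).mono_size ?_
  simp only [Fintype.card_fin, Fintype.card_prod, Fintype.card_option]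
  nlinarith [Nat.zero_le (T.states * s * N), Nat.zero_le (T.tapes * (T.symbols + 1) * s)]

theorem StackMachine.exists_reach_step (T : StackMachine) :
    ∃ K, ∀ (X : Type) (N : ℕ) (c : X → T.Config),
      Reach (configBits T (N + T.depth) c) (K * (N + 1)) (configBits T N fun x => T.step (c x)) := by
  let V := Fin T.states × (Fin T.tapes → Fin T.depth → Option (Fin T.symbols))
  let K₁ := Fintype.card V * (0 + (T.tapes * (T.depth * (0 + 1) + 1 + 1) + 1) + 1)
  let s := Fintype.card V * (0 + 1 + 1 + 1) + 1
  refine ⟨K₁ + (T.states + T.tapes * (T.symbols + 1)) * s, fun X N c => ?_⟩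
  let F := configBits T (N + T.depth) c
  let G := Set.range fun (v : V) x => decide (T.view (c x) = v)
  have hview : Reach F K₁ G := by
    refine Reach.range_fintype fun v => ?_
    have h1 : Reach F 0 {fun x => decide ((c x).1 = v.1)} := .of_mem (Or.inl ⟨v.1, rfl⟩)
    have h2 := Reach.forall_fintype (F := F) (p := fun k x =>
        ∀ j : Fin T.depth, ((c x).2 k)[(j : ℕ)]? = v.2 k j) fun k =>
      Reach.forall_fintype (p := fun (j : Fin T.depth) x => ((c x).2 k)[(j : ℕ)]? = v.2 k j)
        fun j => Reach.of_mem (Or.inr ⟨⟨k, Fin.castLE (Nat.le_add_left _ _) j, v.2 k j⟩, rfl⟩)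
    have h3 := h1.decide_and h2
    simp only [Fintype.card_fin] at h3
    convert h3 using 4 with x
    simp [StackMachine.view, Prod.ext_iff, funext_iff]
  have hG : ∀ v, Reach (F ∪ G) 0 {fun x => decide (T.view (c x) = v)} := fun v =>
    .of_mem (Or.inr ⟨v, rfl⟩)
  have hstep : Reach (F ∪ G) ((T.states + T.tapes * (T.symbols + 1)) * s * (N + 1))
      (configBits T N fun x => T.step (c x)) := by
    refine reach_configBits T (fun q => ?_) fun k j hj o => ?_
    · have := Reach.exists_fintype (F := F ∪ G) (p := fun (v : V) x => T.view (c x) = v ∧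
        (T.trans v.1 v.2).1 = q) fun v => (hG v).decide_and (Reach.decide_const _)
      convert this using 4 with x
      simp [StackMachine.step]
    · have := Reach.exists_fintype (F := F ∪ G) (p := fun (v : V) x => T.view (c x) = v ∧
        ((T.trans v.1 v.2).2 k ++ ((c x).2 k).drop T.depth)[j]? = o)
        fun v => (hG v).decide_and (t := 1) ?_
      · convert this using 4 with x
        simp [StackMachine.step]
      · by_cases h : j < ((T.trans v.1 v.2).2 k).length
        · simp only [List.getElem?_append_left h]
          exact Reach.decide_const _
        · rw [not_lt] at h
          simp only [List.getElem?_append_right h, List.getElem?_drop]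
          refine (Reach.of_mem (Or.inl (Or.inr ⟨⟨k, ⟨T.depth + (j -
            ((T.trans v.1 v.2).2 k).length), by omega⟩, o⟩, rfl⟩))).mono_size (Nat.zero_le 1)
  refine (hview.keep.trans hstep).mono_size ?_
  nlinarith [Nat.zero_le (K₁ * N)]

theorem StackMachine.exists_reach_iterate (T : StackMachine) :
    ∃ K, ∀ (X : Type) (N t : ℕ) (c : X → T.Config),
      Reach (configBits T (N + t * T.depth) c) (t * (K * (N + t * T.depth + 1)))
        (configBits T N fun x => (T.step)^[t] (c x)) := by
  obtain ⟨K, hK⟩ := T.exists_reach_step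
  refine ⟨K, fun X N t => ?_⟩
  induction t with
  | zero => intro c; exact .done _ (by simp)
  | succ t ih =>
    intro c
    have h1 := hK X (N + t * T.depth) c
    rw [show N + t * T.depth + T.depth = N + (t + 1) * T.depth by ring] at h1
    refine (h1.trans (ih fun x => T.step (c x))).mono_size ?_
    have h2 : N + t * T.depth ≤ N + (t + 1) * T.depth := by
      rw [Nat.succ_mul]; omega
    rw [Nat.succ_mul, Nat.add_comm]
    gcongr

theorem StackMachine.exists_length_iterate_le (T : StackMachine) :
    ∃ K, ∀ (c : T.Config) (k : Fin T.tapes) (t : ℕ),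
      (((T.step)^[t] c).2 k).length ≤ (c.2 k).length + t * K := by
  let V := Fin T.states × (Fin T.tapes → Fin T.depth → Option (Fin T.symbols))
  let K := ∑ v : V, ∑ k, ((T.trans v.1 v.2).2 k).length
  have h1 : ∀ (v : V) k, ((T.trans v.1 v.2).2 k).length ≤ K := fun v k =>
    (Finset.single_le_sum (f := fun k => ((T.trans v.1 v.2).2 k).length) (fun _ _ => Nat.zero_le _)
      (Finset.mem_univ k)).trans (Finset.single_le_sum (f := fun v : V => ∑ k,
        ((T.trans v.1 v.2).2 k).length) (fun _ _ => Nat.zero_le _) (Finset.mem_univ v))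
  refine ⟨K, fun c k t => ?_⟩
  induction t with
  | zero => simp
  | succ t ih =>
    rw [Function.iterate_succ_apply', Nat.succ_mul]
    have := h1 (T.view ((T.step)^[t] c)) k
    simp only [StackMachine.step, List.length_append, List.length_drop] at ih ⊢
    omega

theorem testBit_ofBits (s : List Bool) (j : ℕ) : (ofBits s).testBit j = s.getD j false := by
  induction s generalizing j with
  | nil => simp [ofBits]
  | cons x s ih =>
    change (Nat.bit x (ofBits s)).testBit j = _
    cases j with
    | zero => simp
    | succ j => rw [Nat.testBit_bit_succ, ih]; simp

theorem ofBits_eq_iff {s : List Bool} {i N : ℕ} (hs : s.length ≤ N) (hi : i < 2 ^ N) :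
    ofBits s = i ↔ ∀ j : Fin N, s.getD j false = i.testBit j := by
  constructor
  · rintro rfl j
    rw [testBit_ofBits]
  · intro h
    refine Nat.eq_of_testBit_eq fun j => ?_
    rw [testBit_ofBits]
    by_cases hj : j < N
    · exact h ⟨j, hj⟩
    · rw [Nat.testBit_lt_two_pow (hi.trans_le (Nat.pow_le_pow_right two_pos (not_lt.1 hj))),
        List.getD_eq_default _ _ (hs.trans (not_lt.1 hj))]

theorem eval_mono (P : Polynomial ℕ) {m n : ℕ} (h : m ≤ n) : P.eval m ≤ P.eval n := by
  rw [Polynomial.eval_eq_sum, Polynomial.eval_eq_sum]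
  exact Finset.sum_le_sum fun i _ => Nat.mul_le_mul_left _ (Nat.pow_le_pow_left h i)

/-- Polynomial time functions have circuits of polynomial size. -/
theorem PolyTime.exists_reach {f : List Bool → List Bool} (hf : PolyTime f) :
    ∃ P : Polynomial ℕ, ∀ (X : Type) (F : Set (X → Bool)) (l : List (X → Bool)) (i : ℕ),
      (∀ g ∈ l, g ∈ F) →
      Reach F (P.eval (l.length + i)) {fun x => decide (ofBits (f (l.map fun g => g x)) = i)} := by
  obtain ⟨T, q, k₀, k₁, enc, dec, time, hT⟩ := hf.exists_stackMachine
  obtain ⟨K, hK⟩ := T.exists_reach_iterate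
  obtain ⟨K', hK'⟩ := T.exists_length_iterate_le
  let len : Polynomial ℕ := Polynomial.X + time * Polynomial.C K'
  let tot : Polynomial ℕ := len + time * Polynomial.C T.depth + 1
  refine ⟨Polynomial.C (T.states + T.tapes * (T.symbols + 1)) * tot + time * (Polynomial.C K * tot) +
    (len * Polynomial.C (T.symbols + 4) + 1), fun X F l i hl => ?_⟩
  let m := l.length + i
  let t := time.eval l.length
  have ht : t ≤ time.eval m := eval_mono _ (Nat.le_add_right _ _)
  let N := m + t * K'
  let c : X → T.Config := fun x => T.initial q k₀ ((l.map fun g => g x).map enc)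
  have h1 : Reach F ((T.states + T.tapes * (T.symbols + 1)) * 1 * (N + t * T.depth + 1))
      (configBits T (N + t * T.depth) c) := by
    refine reach_configBits T (fun q' => ?_) fun k j _ o => ?_
    · exact Reach.decide_const (q = q')
    · by_cases hk : k = k₀
      · by_cases hj : j < l.length
        · simp only [c, StackMachine.initial, hk, if_true, List.map_map, List.getElem?_map,
            List.getElem?_eq_getElem hj, Option.map_some]
          have hmem := hl _ (List.getElem_mem hj)
          generalize l[j] = g at hmem
          by_cases ht : some (enc true) = o <;> by_cases hf : some (enc false) = o
          · convert Reach.constant (F := F) true using 2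
            funext x
            cases h : g x <;> simp [h, ht, hf]
          · convert (Reach.of_mem hmem).mono_size (Nat.zero_le 1) using 2
            funext x
            cases h : g x <;> simp [h, ht, hf]
          · convert (Reach.of_mem hmem).gate_not using 2
            funext x
            cases h : g x <;> simp [h, ht, hf]
          · convert Reach.constant (F := F) false using 2
            funext x
            cases h : g x <;> simp [h, ht, hf]
        · simp only [c, StackMachine.initial, hk, if_true, List.map_map, List.getElem?_map,
            List.getElem?_eq_none (not_lt.1 hj), Option.map_none]
          exact Reach.decide_const _
      · simp only [c, StackMachine.initial, hk, if_false]
        exact Reach.decide_const _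
  have h2 := h1.trans (hK X N t c)
  have h3 : Reach (configBits T N fun x => (T.step)^[t] (c x)) (N * (T.symbols + 3) + 1)
      {fun x => decide (ofBits (f (l.map fun g => g x)) = i)} := by
    have hbit : ∀ j : Fin N, Reach (configBits T N fun x => (T.step)^[t] (c x)) (T.symbols + 2)
        {fun x => decide ((f (l.map fun g => g x)).getD j false = i.testBit j)} := by
      intro j
      have h4 : Reach (configBits T N fun x => (T.step)^[t] (c x))
          (Fintype.card {a // dec a = true} * (0 + 1) + 1)
          {fun x => decide ((f (l.map fun g => g x)).getD j false = true)} := by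
        have := Reach.exists_fintype (F := configBits T N fun x => (T.step)^[t] (c x))
          (p := fun (a : {a // dec a = true}) x =>
            (((T.step)^[t] (c x)).2 k₁)[(j : ℕ)]? = some a.1) fun a =>
            Reach.of_mem (Or.inr ⟨⟨k₁, j, some a.1⟩, rfl⟩)
        convert this using 4 with x
        rw [← hT, List.length_map, List.getD_eq_getElem?_getD, List.getElem?_map]
        change (((((T.step)^[t] (c x)).2 k₁)[(j : ℕ)]?).map dec).getD false = true ↔ _
        cases h : (((T.step)^[t] (c x)).2 k₁)[(j : ℕ)]? with
        | none => simp
        | some a => simp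
      have h5 : Fintype.card {a // dec a = true} ≤ T.symbols := by
        simpa using Fintype.card_subtype_le fun a => dec a = true
      cases hi : i.testBit j
      · convert h4.decide_not.mono_size (t := T.symbols + 2) (by omega) using 4 with x
        simp
      · exact h4.mono_size (by omega)
    have h6 := Reach.forall_fintype (p := fun (j : Fin N) x =>
      (f (l.map fun g => g x)).getD j false = i.testBit j) hbit
    rw [Fintype.card_fin] at h6
    convert h6 using 4 with x
    refine ofBits_eq_iff ?_ ?_
    · rw [← hT]
      simp only [List.length_map]
      refine (hK' _ _ _).trans ?_
      have : ((T.initial q k₀ ((l.map fun g => g x).map enc)).2 k₁).length ≤ m := by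
        simp only [StackMachine.initial]
        split_ifs <;> simp [m]
      exact Nat.add_le_add_right this _
    · exact (show i ≤ N by simp only [N, m]; omega).trans_lt Nat.lt_two_pow_self
  refine (h2.trans h3).mono_size ?_
  have hN : N ≤ len.eval m := by
    simp only [N, len, Polynomial.eval_add, Polynomial.eval_X, Polynomial.eval_mul,
      Polynomial.eval_C]
    gcongr
  have htot : N + t * T.depth + 1 ≤ tot.eval m := by
    simp only [tot, Polynomial.eval_add, Polynomial.eval_mul, Polynomial.eval_C,
      Polynomial.eval_one]
    gcongr
  simp only [Polynomial.eval_add, Polynomial.eval_mul, Polynomial.eval_C, Polynomial.eval_one,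
    mul_one]
  change _ ≤ (T.states + T.tapes * (T.symbols + 1)) * tot.eval m +
    time.eval m * (K * tot.eval m) + (len.eval m * (T.symbols + 4) + 1)
  gcongr
  omega

end Machine

end NWGame

namespace NWGame

/-! ### The Student's queries when he is never aborted -/

/-- The moves of a Student who starts with the strings `zs` and to whom the number `i` is always
answered by `r i`, whether it is a legal query or not. -/
def queryRun (r : ℕ → List Bool) : List (List Bool → List Bool) → List (List Bool) → List ℕ
  | [], _ => []
  | S :: Ss, zs =>
    ofBits (S (encodeTuple zs)) ::
      queryRun r Ss (zs ++ [r (ofBits (S (encodeTuple zs)))])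

/-- The queries of a Student who starts with the strings `zs` and to whom the query `i < m` is always
answered by `r i`. -/
def queries (m : ℕ) (r : ℕ → List Bool) (moves : List (List Bool → List Bool))
    (zs : List (List Bool)) : List ℕ :=
  (queryRun r moves zs).takeWhile (· < m)

theorem length_queryRun (r : ℕ → List Bool) (moves : List (List Bool → List Bool))
    (zs : List (List Bool)) : (queryRun r moves zs).length = moves.length := by
  induction moves generalizing zs with
  | nil => rfl
  | cons S Ss ih => simp [queryRun, ih]

theorem queries_cons (m : ℕ) (r : ℕ → List Bool) (S : List Bool → List Bool)
    (Ss : List (List Bool → List Bool)) (zs : List (List Bool)) :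
    queries m r (S :: Ss) zs = if ofBits (S (encodeTuple zs)) < m then
      ofBits (S (encodeTuple zs)) ::
        queries m r Ss (zs ++ [r (ofBits (S (encodeTuple zs)))]) else [] := by
  simp only [queries, queryRun, List.takeWhile_cons, decide_eq_true_eq]

theorem isSome_play_iff (h : Equiv.Perm (List Bool)) (B : List Bool → Bool) (n J b a : ℕ)
    (inp : List (List Bool)) (out : List Bool → List Bool) (moves : List (List Bool → List Bool))
    (ys : List (List Bool)) :
    (play h B n J b a inp out moves ys).isSome = true ↔
      ∀ i ∈ queries (n + 1) (fun i => h.symm (restrict n J i a)) moves (inp ++ ys),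
        genBit h B n J a i = b.testBit i := by
  induction moves generalizing ys with
  | nil => simp [play, queries, queryRun]
  | cons S Ss ih =>
    rw [queries_cons, play]
    simp only
    split_ifs with h1 h2
    · rw [ih]
      simp only [List.append_assoc, List.mem_cons, forall_eq_or_imp]
      exact ⟨fun h => ⟨h2, h⟩, fun h => h.2⟩
    · simp only [Option.isSome_none, Bool.false_eq_true, List.mem_cons, forall_eq_or_imp, false_iff,
        not_and]
      exact fun h => absurd h h2
    · simp

theorem getElem?_queries_congr {m i₀ : ℕ} {r r' : ℕ → List Bool}
    (hr : ∀ i < m, i ≠ i₀ → r i = r' i) (moves : List (List Bool → List Bool))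
    (zs : List (List Bool)) (t : ℕ) (h : ∀ s < t, (queries m r moves zs)[s]? ≠ some i₀) :
    ∀ s ≤ t, (queries m r' moves zs)[s]? = (queries m r moves zs)[s]? := by
  induction moves generalizing zs t with
  | nil => intro s _; rfl
  | cons S Ss ih =>
    intro s hs
    rw [queries_cons] at h
    rw [queries_cons, queries_cons]
    split_ifs at h ⊢ with h1
    · cases s with
      | zero => rfl
      | succ s =>
        obtain ⟨t, rfl⟩ := Nat.exists_eq_add_of_le' (Nat.one_le_of_lt hs)
        have h2 : ofBits (S (encodeTuple zs)) ≠ i₀ := fun h2 => h 0 (Nat.succ_pos _) (by simp [h2])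
        rw [List.getElem?_cons_succ, List.getElem?_cons_succ, ← hr _ h1 h2]
        exact ih _ t (fun s hs => by simpa using h (s + 1) (Nat.succ_lt_succ hs)) s
          (Nat.le_of_succ_le_succ hs)
    · rfl

theorem getElem?_takeWhile_lt_iff (l : List ℕ) (m t i : ℕ) :
    (l.takeWhile (· < m))[t]? = some i ↔
      l[t]? = some i ∧ i < m ∧ ∀ s : Fin t, ∃ i' : Fin m, l[(s : ℕ)]? = some (i' : ℕ) := by
  induction l generalizing t with
  | nil => simp
  | cons a l ih =>
    rw [List.takeWhile_cons]
    by_cases ha : a < m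
    · simp only [ha, decide_true, if_true]
      cases t with
      | zero =>
        simp only [List.getElem?_cons_zero, Option.some.injEq, IsEmpty.forall_iff, and_true]
        exact ⟨fun h => ⟨h, h ▸ ha⟩, fun h => h.1⟩
      | succ t =>
        rw [List.getElem?_cons_succ, List.getElem?_cons_succ, ih, Fin.forall_fin_succ]
        simp only [Fin.val_zero, List.getElem?_cons_zero, Fin.val_succ, List.getElem?_cons_succ]
        refine and_congr_right fun _ => and_congr_right fun _ => ⟨fun h => ⟨⟨⟨a, ha⟩, rfl⟩, h⟩,
          fun h => h.2⟩
    · simp only [ha, decide_false, Bool.false_eq_true, if_false, List.getElem?_nil, reduceCtorEq,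
        false_iff, not_and, not_forall]
      intro h1 h2
      cases t with
      | zero => simp only [List.getElem?_cons_zero, Option.some.injEq] at h1; omega
      | succ t =>
        refine ⟨0, fun ⟨i', hi'⟩ => ha ?_⟩
        simp only [Fin.val_zero, List.getElem?_cons_zero, Option.some.injEq] at hi'
        exact hi' ▸ i'.2

section Symbolic

variable {X : Type}

/-- The list of strings depending on `x` whose bits are given by the functions in `zl`. -/
def evalStrings (zl : List (List (X → Bool))) (x : X) : List (List Bool) :=
  zl.map fun l => l.map fun f => f x

/-- The bits of `encodeTuple` as functions of `x`. -/
def symbolicEncode (zl : List (List (X → Bool))) : List (X → Bool) :=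
  zl.flatMap fun l => l.flatMap (fun f => [fun _ => true, f]) ++ [fun _ => false]

theorem map_symbolicEncode (zl : List (List (X → Bool))) (x : X) :
    (symbolicEncode zl).map (fun f => f x) = encodeTuple (evalStrings zl x) := by
  simp [symbolicEncode, encodeTuple, evalStrings, List.map_flatMap, List.flatMap_map]

theorem length_symbolicEncode_append (zl : List (List (X → Bool))) (l : List (X → Bool)) :
    (symbolicEncode (zl ++ [l])).length = (symbolicEncode zl).length + (l.length * 2 + 1) := by
  simp [symbolicEncode, List.length_flatMap]

theorem mem_of_mem_symbolicEncode {F : Set (X → Bool)} (hF : ∀ c, (fun _ => c) ∈ F)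
    {zl : List (List (X → Bool))} (hzl : ∀ l ∈ zl, ∀ f ∈ l, f ∈ F) :
    ∀ f ∈ symbolicEncode zl, f ∈ F := by
  intro f hf
  simp only [symbolicEncode, List.mem_flatMap, List.mem_append, List.mem_cons, List.not_mem_nil,
    or_false] at hf
  obtain ⟨l, hl, ⟨g, hg, rfl | rfl⟩ | rfl⟩ := hf
  · exact hF true
  · exact hzl l hl f hg
  · exact hF false

/-- The replies given by a table of functions. -/
def tableReply (m ℓ : ℕ) (tbl : ℕ → List (X → Bool)) (x : X) (i : ℕ) : List Bool :=
  if i < m then (tbl i).map fun f => f x else List.replicate ℓ false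

theorem exists_reach_queryRun (moves : List (List Bool → List Bool))
    (hmoves : ∀ S ∈ moves, PolyTime S) :
    ∃ P : Polynomial ℕ, ∀ (X : Type) (F : Set (X → Bool)) (m ℓ R sz : ℕ)
      (tbl : ℕ → List (X → Bool)) (zl : List (List (X → Bool))),
      (∀ c, (fun _ => c) ∈ F) → (∀ i < m, (tbl i).length = ℓ) →
      (∀ i < m, ∀ f ∈ tbl i, Reach F R {f}) → (∀ l ∈ zl, ∀ f ∈ l, f ∈ F) →
      (symbolicEncode zl).length ≤ sz → m ≤ sz → ℓ ≤ sz → R ≤ sz →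
      Reach F (P.eval sz) {g | ∃ t : ℕ, ∃ i < m, g = fun x =>
        decide ((queryRun (tableReply m ℓ tbl x) moves (evalStrings zl x))[t]? = some i)} := by
  induction moves with
  | nil =>
    refine ⟨0, fun X F m ℓ R sz tbl zl hF _ _ _ _ _ _ _ => .done _ ?_⟩
    rintro _ ⟨t, i, _, rfl⟩
    simpa [queryRun] using hF false
  | cons S Ss ih =>
    obtain ⟨P, hP⟩ := ih fun T hT => hmoves T (by simp [hT])
    obtain ⟨P₁, hP₁⟩ := (hmoves S (by simp)).exists_reach
    refine ⟨Polynomial.X * P₁.comp (2 * Polynomial.X) +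
      Polynomial.X * (Polynomial.X * (Polynomial.X + 3) + 1) + P.comp (3 * Polynomial.X + 1),
      fun X F m ℓ R sz tbl zl hF htbl hR hzl hlen hm hℓ hRs => ?_⟩
    let i : X → ℕ := fun x => ofBits (S (encodeTuple (evalStrings zl x)))
    let I : Set (X → Bool) := Set.range fun (i' : Fin m) x => decide (i x = i')
    let v : Fin ℓ → X → Bool := fun j x =>
      decide (∃ i' : Fin m, i x = i' ∧ ((tbl i').map fun f => f x)[(j : ℕ)]? = some true)
    have h1 : Reach F (m * P₁.eval (2 * sz)) I := by
      have := Reach.range_fintype (F := F) (f := fun (i' : Fin m) x => decide (i x = i'))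
        (s := P₁.eval (2 * sz)) fun i' => by
          have h := hP₁ X F (symbolicEncode zl) i' (mem_of_mem_symbolicEncode hF hzl)
          simp only [map_symbolicEncode] at h
          exact h.mono_size (eval_mono _ (by have := i'.2; omega))
      rwa [Fintype.card_fin] at this
    have h2 : Reach (F ∪ I) (ℓ * (m * (R + 3) + 1)) (Set.range v) := by
      have := Reach.range_fintype (F := F ∪ I) (f := v) (s := m * (0 + (R + 1) + 1 + 1) + 1) fun j => by
        have := Reach.exists_fintype (F := F ∪ I) (s := 0 + (R + 1) + 1) (p := fun (i' : Fin m) x =>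
          i x = i' ∧ ((tbl i').map fun f => f x)[(j : ℕ)]? = some true) fun i' => by
          refine Reach.decide_and (Reach.of_mem (Or.inr ⟨i', rfl⟩)) ?_
          have hj : (j : ℕ) < (tbl i').length := by rw [htbl i' i'.2]; exact j.2
          simp only [List.getElem?_map, List.getElem?_eq_getElem hj, Option.map_some,
            Option.some.injEq, Bool.decide_eq_true]
          exact ((hR i' i'.2 _ (List.getElem_mem hj)).mono_left Set.subset_union_left).mono_size
            (Nat.le_succ _)
        rwa [Fintype.card_fin] at this
      rw [Fintype.card_fin] at this
      exact this.mono_size (le_of_eq (by ring))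
    have h3 := hP X (F ∪ I ∪ Set.range v) m ℓ R (3 * sz + 1) tbl (zl ++ [List.ofFn v])
      (fun c => Or.inl (Or.inl (hF c))) htbl
      (fun i hi f hf => (hR i hi f hf).mono_left
        (Set.subset_union_left.trans Set.subset_union_left)) (by
        intro l hl f hf
        rw [List.mem_append, List.mem_singleton] at hl
        rcases hl with hl | rfl
        · exact Or.inl (Or.inl (hzl l hl f hf))
        · exact Or.inr (by simpa using hf)) (by
        rw [length_symbolicEncode_append, List.length_ofFn]; omega) (by omega) (by omega) (by omega)
    have hreply : ∀ x, (List.ofFn v).map (fun f => f x) = tableReply m ℓ tbl x (i x) := by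
      intro x
      have hv : (List.ofFn v).map (fun f => f x) = List.ofFn fun j => v j x := by
        rw [List.map_ofFn]; rfl
      rw [hv]
      unfold tableReply
      split_ifs with hi
      · refine List.ext_getElem (by simp [htbl _ hi]) fun j hj hj' => ?_
        rw [List.getElem_ofFn, Bool.eq_iff_iff, decide_eq_true_eq]
        simp only
        constructor
        · rintro ⟨i', hi', h⟩
          rw [← hi'] at h
          rw [List.getElem?_eq_getElem hj', Option.some.injEq] at h
          exact h
        · intro h
          exact ⟨⟨i x, hi⟩, rfl, by rw [List.getElem?_eq_getElem hj', h]⟩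
      · refine List.ext_getElem (by simp) fun j hj hj' => ?_
        rw [List.getElem_ofFn, List.getElem_replicate, decide_eq_false_iff_not]
        rintro ⟨i', hi', -⟩
        exact hi (hi' ▸ i'.2)
    have h4 := (h1.keep.trans h2.keep).trans h3.keep
    refine (h4.mono_right ?_).mono_size ?_
    · rintro _ ⟨t, i', hi', rfl⟩
      cases t with
      | zero =>
        refine Or.inl (Or.inl (Or.inr ⟨⟨i', hi'⟩, ?_⟩))
        simp [queryRun, i]
      | succ t =>
        refine Or.inr ⟨t, i', hi', ?_⟩
        funext x
        simp only [queryRun, List.getElem?_cons_succ, evalStrings, List.map_append, List.map_cons,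
          List.map_nil, hreply]
        rfl
    · simp only [Polynomial.eval_add, Polynomial.eval_mul, Polynomial.eval_X, Polynomial.eval_comp,
        Polynomial.eval_ofNat, Polynomial.eval_one]
      gcongr

theorem exists_reach_queries (S : Student) :
    ∃ P : Polynomial ℕ, ∀ (X : Type) (F : Set (X → Bool)) (m ℓ R sz : ℕ)
      (tbl : ℕ → List (X → Bool)) (zl : List (List (X → Bool))),
      (∀ c, (fun _ => c) ∈ F) → (∀ i < m, (tbl i).length = ℓ) →
      (∀ i < m, ∀ f ∈ tbl i, Reach F R {f}) → (∀ l ∈ zl, ∀ f ∈ l, f ∈ F) →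
      (symbolicEncode zl).length ≤ sz → m ≤ sz → ℓ ≤ sz → R ≤ sz → ∀ t, ∀ i < m,
      Reach F ((P + Polynomial.C t * (Polynomial.X + 2) + 2).eval sz) {fun x =>
        decide ((queries m (tableReply m ℓ tbl x) S.moves (evalStrings zl x))[t]? = some i)} := by
  obtain ⟨P, hP⟩ := exists_reach_queryRun S.moves S.polyTime_moves
  refine ⟨P, fun X F m ℓ R sz tbl zl hF htbl hR hzl hlen hm hℓ hRs t i hi => ?_⟩
  have h1 := hP X F m ℓ R sz tbl zl hF htbl hR hzl hlen hm hℓ hRs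
  refine (h1.trans (Reach.mono_size (s := 0 + (t * (m * (0 + 1) + 1 + 1) + 1) + 1) ?_
    (t := t * (sz + 2) + 2) ?_)).mono_size ?_
  · have h2 := fun (s : Fin t) => Reach.exists_fintype (s := 0) (F := {g | ∃ t : ℕ, ∃ i < m, g = fun x =>
        decide ((queryRun (tableReply m ℓ tbl x) S.moves (evalStrings zl x))[t]? = some i)})
        (p := fun (i' : Fin m) x =>
      (queryRun (tableReply m ℓ tbl x) S.moves (evalStrings zl x))[(s : ℕ)]? = some (i' : ℕ))
      fun i' => Reach.of_mem ⟨s, i', i'.2, rfl⟩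
    have h3 := Reach.forall_fintype h2
    simp only [Fintype.card_fin] at h3
    have h4 := (Reach.of_mem (F := {g | ∃ t : ℕ, ∃ i < m, g = fun x =>
        decide ((queryRun (tableReply m ℓ tbl x) S.moves (evalStrings zl x))[t]? = some i)})
        ⟨t, i, hi, rfl⟩).decide_and h3
    convert h4 using 4 with x
    rw [queries, getElem?_takeWhile_lt_iff]
    simp [hi]
  · have := Nat.mul_le_mul_left t (show m * (0 + 1) + 1 + 1 ≤ sz + 2 by omega)
    omega
  · simp [add_assoc]

/-- The prediction test: the round `q` of one of the Students is the query `i₀`, and no query in the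
rounds `idx` is bad. -/
theorem exists_reach_prediction (q : Student × ℕ) (idx : List (Student × ℕ)) :
    ∃ P : Polynomial ℕ, ∀ (X : Type) (F : Set (X → Bool)) (m ℓ R sz i₀ : ℕ)
      (tbl : ℕ → List (X → Bool)) (zl : List (List (X → Bool))) (bad : ℕ → X → Bool),
      i₀ < m → (∀ c, (fun _ => c) ∈ F) → (∀ i < m, (tbl i).length = ℓ) →
      (∀ i < m, ∀ f ∈ tbl i, Reach F R {f}) → (∀ i < m, Reach F R {bad i}) →
      (∀ l ∈ zl, ∀ f ∈ l, f ∈ F) →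
      (symbolicEncode zl).length ≤ sz → m ≤ sz → ℓ ≤ sz → R ≤ sz →
      Reach F (P.eval sz) {fun x => decide (
        (queries m (tableReply m ℓ tbl x) q.1.moves (evalStrings zl x))[q.2]? = some i₀ ∧
        ∀ y ∈ idx, ∀ i : Fin m, ¬ ((queries m (tableReply m ℓ tbl x) y.1.moves
          (evalStrings zl x))[y.2]? = some (i : ℕ) ∧ bad i x = true))} := by
  have key : ∃ P : Polynomial ℕ, ∀ (X : Type) (F : Set (X → Bool)) (m ℓ R sz : ℕ)
      (tbl : ℕ → List (X → Bool)) (zl : List (List (X → Bool))),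
      (∀ c, (fun _ => c) ∈ F) → (∀ i < m, (tbl i).length = ℓ) →
      (∀ i < m, ∀ f ∈ tbl i, Reach F R {f}) → (∀ l ∈ zl, ∀ f ∈ l, f ∈ F) →
      (symbolicEncode zl).length ≤ sz → m ≤ sz → ℓ ≤ sz → R ≤ sz → ∀ y ∈ q :: idx, ∀ i < m,
      Reach F (P.eval sz) {fun x =>
        decide ((queries m (tableReply m ℓ tbl x) y.1.moves (evalStrings zl x))[y.2]? = some i)} := by
    generalize q :: idx = l
    induction l with
    | nil => exact ⟨0, by simp⟩
    | cons y l ih =>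
      obtain ⟨P, hP⟩ := ih
      obtain ⟨P₁, hP₁⟩ := exists_reach_queries y.1
      refine ⟨P + (P₁ + Polynomial.C y.2 * (Polynomial.X + 2) + 2),
        fun X F m ℓ R sz tbl zl hF htbl hR hzl hlen hm hℓ hRs y' hy' i hi => ?_⟩
      rw [Polynomial.eval_add]
      rw [List.mem_cons] at hy'
      rcases hy' with rfl | hy'
      · exact (hP₁ X F m ℓ R sz tbl zl hF htbl hR hzl hlen hm hℓ hRs y'.2 i hi).mono_size
          (Nat.le_add_left _ _)
      · exact (hP X F m ℓ R sz tbl zl hF htbl hR hzl hlen hm hℓ hRs y' hy' i hi).mono_size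
          (Nat.le_add_right _ _)
  obtain ⟨P, hP⟩ := key
  refine ⟨P + (Polynomial.C idx.length * (Polynomial.X * (P + Polynomial.X + 3) + 2) + 1) + 1,
    fun X F m ℓ R sz i₀ tbl zl bad hi₀ hF htbl hR hbad hzl hlen hm hℓ hRs => ?_⟩
  have hq := hP X F m ℓ R sz tbl zl hF htbl hR hzl hlen hm hℓ hRs
  have h1 : ∀ y ∈ idx, Reach F (m * (P.eval sz + R + 1 + 1 + 1) + 1) {fun x => decide
      (∀ i : Fin m, ¬ ((queries m (tableReply m ℓ tbl x) y.1.moves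
          (evalStrings zl x))[y.2]? = some (i : ℕ) ∧ bad i x = true))} := fun y hy => by
    have := Reach.forall_fintype (F := F) (p := fun (i : Fin m) x =>
      ¬ ((queries m (tableReply m ℓ tbl x) y.1.moves
          (evalStrings zl x))[y.2]? = some (i : ℕ) ∧ bad i x = true))
      (s := P.eval sz + R + 1 + 1) fun i =>
        ((hq y (by simp [hy]) i i.2).decide_and (by simpa using hbad i i.2)).decide_not
    rwa [Fintype.card_fin] at this
  have h2 := Reach.all_list idx h1
  have h3 : Reach F (idx.length * (m * (P.eval sz + R + 1 + 1 + 1) + 1 + 1) + 1) {fun x => decide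
      (∀ y ∈ idx, ∀ i : Fin m, ¬ ((queries m (tableReply m ℓ tbl x) y.1.moves
          (evalStrings zl x))[y.2]? = some (i : ℕ) ∧ bad i x = true))} := by
    convert h2 using 3 with x
    rw [Bool.eq_iff_iff]
    simp
  refine ((hq q (by simp) i₀ hi₀).decide_and h3).mono_size ?_
  simp only [Polynomial.eval_add, Polynomial.eval_mul, Polynomial.eval_X, Polynomial.eval_C,
    Polynomial.eval_ofNat, Polynomial.eval_one, add_assoc, Nat.reduceAdd]
  gcongr

end Symbolic

end NWGame

namespace NWGame

/-! ### Prediction of the hard bit -/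

theorem IsHardBit.exists_forall_circuit {h : Equiv.Perm (List Bool)} {B : List Bool → Bool}
    (hB : IsHardBit h B) (q : Polynomial ℕ) {k : ℕ} (hk : 1 ≤ k) :
    ∃ ℓ₀ : ℕ, ∀ ℓ ≥ ℓ₀, ∀ C : Circuit, C.length ≤ q.eval ℓ →
      ((Finset.univ.filter fun u : Fin ℓ → Bool =>
          C.eval (List.ofFn u) = B (h.symm (List.ofFn u))).card : ℝ) / 2 ^ ℓ
        ≤ 1 / 2 + 1 / (ℓ : ℝ) ^ k := by
  classical
  let bad : ℕ → Circuit → Prop := fun ℓ C => C.length ≤ q.eval ℓ ∧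
    ¬ ((Finset.univ.filter fun u : Fin ℓ → Bool =>
          C.eval (List.ofFn u) = B (h.symm (List.ofFn u))).card : ℝ) / 2 ^ ℓ
        ≤ 1 / 2 + 1 / (ℓ : ℝ) ^ k
  let D : ℕ → Circuit := fun ℓ => if hC : ∃ C, bad ℓ C then hC.choose else []
  have hD : ∀ ℓ, (D ℓ).length ≤ q.eval ℓ := fun ℓ => by
    by_cases hC : ∃ C, bad ℓ C
    · simp only [D, dif_pos hC]
      exact hC.choose_spec.1
    · simp [D, dif_neg hC]
  obtain ⟨ℓ₀, h₀⟩ := Filter.eventually_atTop.1 (hB D ⟨q, hD⟩ k hk)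
  refine ⟨ℓ₀, fun ℓ hℓ C hC => ?_⟩
  by_contra hcon
  have hex : ∃ C, bad ℓ C := ⟨C, hC, hcon⟩
  have h1 := h₀ ℓ hℓ
  simp only [D, dif_pos hex] at h1
  exact hex.choose_spec.2 h1

theorem card_le_of_predictors {X : Type} [Fintype X] (D g : X → Bool) (bb : Bool) (η : ℝ)
    (hη : ∀ c, ((Finset.univ.filter fun x => ((D x && !bb) || (!D x && c)) = g x).card : ℝ) ≤
      Fintype.card X / 2 + η) :
    ((Finset.univ.filter fun x => D x = true ∧ ¬ g x = bb).card : ℝ) ≤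
      (Finset.univ.filter fun x => D x = true ∧ g x = bb).card + 2 * η := by
  have h1 : (Finset.univ.filter fun x => ((D x && !bb) || (!D x && true)) = g x).card +
      (Finset.univ.filter fun x => ((D x && !bb) || (!D x && false)) = g x).card +
      (Finset.univ.filter fun x => D x = true ∧ g x = bb).card =
      (Finset.univ.filter fun x => D x = true ∧ ¬ g x = bb).card + Fintype.card X := by
    rw [← Finset.card_univ, Finset.card_eq_sum_ones (Finset.univ : Finset X)]
    simp only [Finset.card_filter]
    rw [← Finset.sum_add_distrib, ← Finset.sum_add_distrib, ← Finset.sum_add_distrib]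
    refine Finset.sum_congr rfl fun x _ => ?_
    cases D x <;> cases g x <;> cases bb <;> rfl
  have h2 := hη true
  have h3 := hη false
  have h4 : (((Finset.univ.filter fun x => ((D x && !bb) || (!D x && true)) = g x).card : ℝ) +
      (Finset.univ.filter fun x => ((D x && !bb) || (!D x && false)) = g x).card +
      (Finset.univ.filter fun x => D x = true ∧ g x = bb).card) =
      (Finset.univ.filter fun x => D x = true ∧ ¬ g x = bb).card + Fintype.card X := by
    exact_mod_cast h1
  linarith

theorem sum_card_extend {n ℓ : ℕ} {e : Fin ℓ → Fin n} (he : Function.Injective e)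
    (P : (Fin n → Bool) → Prop) [DecidablePred P] :
    ∑ ρ : Fin n → Bool, (Finset.univ.filter fun u : Fin ℓ → Bool =>
      P (Function.extend e u ρ)).card = 2 ^ ℓ * (Finset.univ.filter P).card := by
  have hres : ∀ (u : Fin ℓ → Bool) (ρ : Fin n → Bool), Function.extend e u ρ ∘ e = u := fun u ρ => by
    funext r
    exact he.extend_apply u ρ r
  have hext : ∀ (u : Fin ℓ → Bool) (ρ : Fin n → Bool),
      Function.extend e (ρ ∘ e) (Function.extend e u ρ) = ρ := fun u ρ => by
    funext j
    by_cases hj : ∃ r, e r = j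
    · obtain ⟨r, rfl⟩ := hj
      rw [he.extend_apply]; rfl
    · rw [Function.extend_apply' _ _ _ hj, Function.extend_apply' _ _ _ hj]
  let φ : (Fin n → Bool) × (Fin ℓ → Bool) → (Fin n → Bool) × (Fin ℓ → Bool) :=
    fun p => (Function.extend e p.2 p.1, p.1 ∘ e)
  have hφ : Function.Involutive φ := fun p => by
    simp only [φ, hext, hres]
  simp only [Finset.card_filter]
  rw [← Fintype.sum_prod_type' (f := fun ρ u => if P (Function.extend e u ρ) then 1 else 0)]
  calc ∑ p : (Fin n → Bool) × (Fin ℓ → Bool), (if P (Function.extend e p.2 p.1) then 1 else 0)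
      = ∑ p : (Fin n → Bool) × (Fin ℓ → Bool), (if P p.1 then 1 else 0) :=
        Equiv.sum_comp hφ.toPerm fun p => if P p.1 then 1 else 0
    _ = _ := by
        rw [Fintype.sum_prod_type, Finset.mul_sum]
        refine Finset.sum_congr rfl fun A _ => ?_
        by_cases hA : P A <;> simp [hA]

/-- One round of the game: `S` are the samples that survived so far. -/
theorem card_le_two_mul_card_surviving {Ω : Type} (S : Finset Ω) (Q : Ω → Option ℕ)
    {m : ℕ} (hQ : ∀ A i, Q A = some i → i < m) (asked ok : ℕ → Ω → Prop)
    [∀ i, DecidablePred (asked i)] [∀ i, DecidablePred (ok i)]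
    [DecidablePred fun A => ∀ i, Q A = some i → ok i A]
    (hasked : ∀ A ∈ S, ∀ i, asked i A → ok i A) (δ : ℝ)
    (hδ : ∀ i < m, ((S.filter fun A => (Q A = some i ∧ ¬ asked i A) ∧ ¬ ok i A).card : ℝ) ≤
      (S.filter fun A => (Q A = some i ∧ ¬ asked i A) ∧ ok i A).card + δ) :
    (S.card : ℝ) ≤ 2 * (S.filter fun A => ∀ i, Q A = some i → ok i A).card + m * δ := by
  classical
  let bad : ℕ → Finset Ω := fun i => S.filter fun A => (Q A = some i ∧ ¬ asked i A) ∧ ¬ ok i A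
  let good : ℕ → Finset Ω := fun i => S.filter fun A => (Q A = some i ∧ ¬ asked i A) ∧ ok i A
  have h1 : (S.filter fun A => ¬ ∀ i, Q A = some i → ok i A).card ≤
      ∑ i ∈ Finset.range m, (bad i).card := by
    refine (Finset.card_le_card fun A hA => ?_).trans Finset.card_biUnion_le
    rw [Finset.mem_filter] at hA
    obtain ⟨hS, hA⟩ := hA
    push Not at hA
    obtain ⟨i, hi, hok⟩ := hA
    rw [Finset.mem_biUnion]
    exact ⟨i, Finset.mem_range.2 (hQ A i hi), Finset.mem_filter.2 ⟨hS, ⟨hi, fun h =>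
      hok (hasked A hS i h)⟩, hok⟩⟩
  have h2 : ∑ i ∈ Finset.range m, (good i).card ≤
      (S.filter fun A => ∀ i, Q A = some i → ok i A).card := by
    rw [← Finset.card_biUnion]
    · refine Finset.card_le_card fun A hA => ?_
      rw [Finset.mem_biUnion] at hA
      obtain ⟨i, _, hi⟩ := hA
      rw [Finset.mem_filter] at hi ⊢
      refine ⟨hi.1, fun j hj => ?_⟩
      rw [hi.2.1.1, Option.some.injEq] at hj
      exact hj ▸ hi.2.2
    · intro i _ j _ hij
      change Disjoint (good i) (good j)
      rw [Finset.disjoint_left]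
      intro A hA hA'
      rw [Finset.mem_filter] at hA hA'
      have := hA.2.1.1.symm.trans hA'.2.1.1
      rw [Option.some.injEq] at this
      exact hij this
  have h3 : ∑ i ∈ Finset.range m, ((bad i).card : ℝ) ≤
      ∑ i ∈ Finset.range m, (((good i).card : ℝ) + δ) :=
    Finset.sum_le_sum fun i hi => hδ i (Finset.mem_range.1 hi)
  rw [Finset.sum_add_distrib, Finset.sum_const, Finset.card_range, nsmul_eq_mul] at h3
  have h4 := Finset.card_filter_add_card_filter_not (s := S) fun A => ∀ i, Q A = some i → ok i A
  have h1' : ((S.filter fun A => ¬ ∀ i, Q A = some i → ok i A).card : ℝ) ≤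
      ∑ i ∈ Finset.range m, ((bad i).card : ℝ) := by exact_mod_cast h1
  have h2' : ∑ i ∈ Finset.range m, ((good i).card : ℝ) ≤
      ((S.filter fun A => ∀ i, Q A = some i → ok i A).card : ℝ) := by exact_mod_cast h2
  have h4' : ((S.filter fun A => ∀ i, Q A = some i → ok i A).card : ℝ) +
    (S.filter fun A => ¬ ∀ i, Q A = some i → ok i A).card = S.card := by exact_mod_cast h4
  linarith

section Positions

theorem length_restrict (n J i a : ℕ) : (restrict n J i a).length = (row n J i).card := by
  have : row n J i = ((List.range n).filter fun j => J.testBit (i * n + j)).toFinset := by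
    ext j
    simp [row]
  rw [this, List.toFinset_card_of_nodup (List.nodup_range.filter _)]
  simp [restrict]

/-- The increasing enumeration of the set `J_i`. -/
theorem exists_enumeration {n J i ℓ : ℕ} (hℓ : (row n J i).card = ℓ) :
    ∃ e : Fin ℓ → Fin n, Function.Injective e ∧
      (∀ r, (e r : ℕ) ∈ row n J i) ∧
      ∀ a, restrict n J i a = List.ofFn fun r => a.testBit (e r) := by
  subst hℓ
  let L := (List.range n).filter fun j => J.testBit (i * n + j)
  have hL : L.length = (row n J i).card := by
    rw [← length_restrict n J i 0]
    simp [restrict, L]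
  have hlt : ∀ r : Fin (row n J i).card, (r : ℕ) < L.length := fun r => hL.symm ▸ r.2
  have hmem : ∀ r : Fin (row n J i).card, L[(r : ℕ)]'(hlt r) ∈ row n J i := fun r => by
    have := List.getElem_mem (hlt r)
    rw [List.mem_filter, List.mem_range] at this
    exact Finset.mem_filter.2 ⟨Finset.mem_range.2 this.1, this.2⟩
  refine ⟨fun r => ⟨L[(r : ℕ)]'(hlt r), ?_⟩, fun r r' hr => ?_, hmem, fun a => ?_⟩
  · have := hmem r
    simp only [row, Finset.mem_filter, Finset.mem_range] at this
    exact this.1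
  · rw [Fin.mk.injEq] at hr
    exact Fin.ext ((List.nodup_range.filter _).getElem_inj_iff.1 hr)
  · refine List.ext_getElem (by rw [length_restrict]; simp) fun j hj hj' => ?_
    rw [List.getElem_ofFn]
    simp [restrict, L]

theorem restrict_congr {n J i a a' : ℕ} (h : ∀ j ∈ row n J i, a.testBit j = a'.testBit j) :
    restrict n J i a = restrict n J i a' := by
  refine List.map_congr_left fun j hj => h j ?_
  simpa [row] using hj

end Positions

end NWGame

namespace NWGame

/-! ### One round of the game -/

/-- The query of the Student `y.1` in the round `y.2` on the sample `a`, if he is not aborted. -/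
def roundQuery (h : Equiv.Perm (List Bool)) (n J b p w : ℕ) (y : Student × ℕ) (a : ℕ) : Option ℕ :=
  (queries (n + 1) (fun i => h.symm (restrict n J i a)) y.1.moves
    [bits n a, bits ((n + 1) * n) J, bits (n + 1) b, bits p w])[y.2]?

theorem lt_of_getElem?_queries {m : ℕ} {r : ℕ → List Bool} {moves : List (List Bool → List Bool)}
    {zs : List (List Bool)} {t i : ℕ} (h : (queries m r moves zs)[t]? = some i) : i < m := by
  have := List.mem_takeWhile_imp (List.mem_of_getElem? h)
  simpa using this

theorem getElem?_queries_test_congr {m i₀ : ℕ} {r r' : ℕ → List Bool}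
    (hr : ∀ i < m, i ≠ i₀ → r i = r' i) (zs : List (List Bool)) {q : Student × ℕ}
    {idx : List (Student × ℕ)} (hq : ∀ s < q.2, (q.1, s) ∈ idx)
    (hidx : ∀ y ∈ idx, ∀ s < y.2, (y.1, s) ∈ idx) {ok : ℕ → Prop}
    (h : (queries m r q.1.moves zs)[q.2]? = some i₀ ∧
      ∀ y ∈ idx, ∀ i, (queries m r y.1.moves zs)[y.2]? = some i → i ≠ i₀ ∧ ok i) :
    (queries m r' q.1.moves zs)[q.2]? = some i₀ ∧
      ∀ y ∈ idx, ∀ i, (queries m r' y.1.moves zs)[y.2]? = some i → i ≠ i₀ ∧ ok i := by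
  have key : ∀ y : Student × ℕ, (∀ s < y.2, (y.1, s) ∈ idx) →
      (queries m r' y.1.moves zs)[y.2]? = (queries m r y.1.moves zs)[y.2]? := fun y hy =>
    getElem?_queries_congr hr y.1.moves zs y.2
      (fun s hs h0 => (h.2 _ (hy s hs) _ h0).1 rfl) y.2 le_rfl
  refine ⟨(key q hq).trans h.1, fun y hy i hi => h.2 y hy i ?_⟩
  rwa [key y (hidx y hy)] at hi

theorem exists_reach_roundQuery (q : Student × ℕ) (idx : List (Student × ℕ)) (e : ℕ)
    (hq : ∀ s < q.2, (q.1, s) ∈ idx) (hidx : ∀ y ∈ idx, ∀ s < y.2, (y.1, s) ∈ idx) :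
    ∃ P : Polynomial ℕ, ∀ (h : Equiv.Perm (List Bool)), (∀ v, (h v).length = v.length) →
      ∀ (B : List Bool → Bool) (n J b p w : ℕ), IsSetSystem n J → p ≤ n ^ e → ∀ i₀ < n + 1,
      ∀ (ℓ : ℕ), (row n J i₀).card = ℓ → ∀ pos : Fin ℓ → Fin n, Function.Injective pos →
      (∀ r, (pos r : ℕ) ∈ row n J i₀) → ∀ ρ : Fin n → Bool,
      Reach (Set.range fun (r : Fin ℓ) u => u r) (P.eval n) {fun u => decide (
        roundQuery h n J b p w q (Nat.ofBits (Function.extend pos u ρ)) = some i₀ ∧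
        ∀ y ∈ idx, ∀ i, roundQuery h n J b p w y (Nat.ofBits (Function.extend pos u ρ)) = some i →
          i ≠ i₀ ∧ genBit h B n J (Nat.ofBits (Function.extend pos u ρ)) i = b.testBit i)} := by
  classical
  obtain ⟨P, hP⟩ := exists_reach_prediction q idx
  let U : Polynomial ℕ := 2 * Polynomial.X + 2 * ((Polynomial.X + 1) * Polynomial.X) +
    2 * (Polynomial.X + 1) + 2 * Polynomial.X ^ e + 4 + 5 * (Polynomial.X + 1)
  refine ⟨2 + P.comp U, fun h hlen B n J b p w hJ hp i₀ hi₀ ℓ hℓ pos hpos hrow ρ => ?_⟩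
  have hU : U.eval n = 2 * n + 2 * ((n + 1) * n) + 2 * (n + 1) + 2 * n ^ e + 4 + 5 * (n + 1) := by
    simp [U]
  have hsymm : ∀ v, (h.symm v).length = v.length := fun v => by
    rw [← hlen, Equiv.apply_symm_apply]
  let a : (Fin ℓ → Bool) → ℕ := fun u => Nat.ofBits (Function.extend pos u ρ)
  let C : Set ((Fin ℓ → Bool) → Bool) := Set.range fun (r : Fin ℓ) u => u r
  let F : Set ((Fin ℓ → Bool) → Bool) := C ∪ Set.range fun c _ => c
  have hC : Reach C 2 F := by
    have := Reach.range_fintype (F := C) (f := fun (c : Bool) (_ : Fin ℓ → Bool) => c) (s := 1)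
      fun c => Reach.constant c
    exact this.keep
  have hFc : ∀ c, (fun _ => c) ∈ F := fun c => Or.inr ⟨c, rfl⟩
  have hFr : ∀ r : Fin ℓ, (fun u => u r) ∈ F := fun r => Or.inl ⟨r, rfl⟩
  have hbit : ∀ u (j : Fin n), (a u).testBit j = Function.extend pos u ρ j := fun u j => by
    rw [Nat.testBit_ofBits_lt _ _ j.2]
  have hcard : ∀ i < n + 1, (row n J i).card = ℓ := fun i hi => by
    rw [← hℓ, hJ.2.1 i hi, hJ.2.1 i₀ hi₀]
  have hℓn : ℓ ≤ n := by
    have := Fintype.card_le_of_injective pos hpos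
    simpa using this
  -- a query `i ≠ i₀` can be answered by a look-up table
  have hdep : ∀ i < n + 1, i ≠ i₀ → ∀ f : List Bool → Bool,
      Reach F (5 * (n + 1)) {fun u => f (restrict n J i (a u))} := by
    intro i hi hne f
    refine (Reach.of_dependsOn hFr (Finset.univ.filter fun r => (pos r : ℕ) ∈ row n J i) _
      fun u u' huu => congrArg f (restrict_congr fun j hj => ?_)).mono_size ?_
    · have hjn : j < n := Finset.mem_range.1 (Finset.mem_filter.1 hj).1
      have h1 := hbit u ⟨j, hjn⟩
      have h2 := hbit u' ⟨j, hjn⟩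
      simp only at h1 h2
      rw [h1, h2]
      by_cases hex : ∃ r, pos r = ⟨j, hjn⟩
      · obtain ⟨r, hr⟩ := hex
        rw [← hr, hpos.extend_apply, hpos.extend_apply]
        refine huu r (Finset.mem_filter.2 ⟨Finset.mem_univ _, ?_⟩)
        rw [hr]; exact hj
      · rw [Function.extend_apply' _ _ _ hex, Function.extend_apply' _ _ _ hex]
    · have h1 : (Finset.univ.filter fun r => (pos r : ℕ) ∈ row n J i).card ≤ Nat.log 2 (n + 1) := by
        refine le_trans ?_ (hJ.2.2 i₀ hi₀ i hi hne.symm)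
        refine Finset.card_le_card_of_injOn (fun r => (pos r : ℕ)) (fun r hr => ?_)
          fun r _ r' _ hrr => hpos (Fin.ext hrr)
        exact Finset.mem_inter.2 ⟨hrow r, (Finset.mem_filter.1 hr).2⟩
      have h2 := Nat.pow_le_pow_right (show 0 < 2 by norm_num) h1
      have h3 := Nat.pow_log_le_self 2 (Nat.succ_ne_zero n)
      have h4 : 2 ^ (Finset.univ.filter fun r => (pos r : ℕ) ∈ row n J i).card ≤ n + 1 :=
        h2.trans h3
      omega
  let tbl : ℕ → List ((Fin ℓ → Bool) → Bool) := fun i =>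
    if i = i₀ then List.replicate ℓ fun _ => false
    else List.ofFn fun (j : Fin ℓ) u => (h.symm (restrict n J i (a u))).getD j false
  let bad : ℕ → (Fin ℓ → Bool) → Bool := fun i u =>
    if i = i₀ then true else decide (genBit h B n J (a u) i ≠ b.testBit i)
  let zl : List (List ((Fin ℓ → Bool) → Bool)) :=
    [(List.range n).map fun j u => (a u).testBit j,
      (bits ((n + 1) * n) J).map fun c _ => c, (bits (n + 1) b).map fun c _ => c,
      (bits p w).map fun c _ => c]
  have hzl : ∀ u, evalStrings zl u =
      [bits n (a u), bits ((n + 1) * n) J, bits (n + 1) b, bits p w] := fun u => by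
    simp [zl, evalStrings, bits, Function.comp_def]
  have hreply : ∀ u, ∀ i < n + 1, i ≠ i₀ →
      tableReply (n + 1) ℓ tbl u i = h.symm (restrict n J i (a u)) := fun u i hi hne => by
    simp only [tableReply, if_pos hi, tbl, if_neg hne]
    refine List.ext_getElem ?_ fun j hj hj' => ?_
    · rw [hsymm, length_restrict, hcard i hi]; simp
    · simp [List.getElem?_eq_getElem hj']
  have main := hP (Fin ℓ → Bool) F (n + 1) ℓ (5 * (n + 1)) (U.eval n) i₀ tbl zl bad hi₀ hFc
    (fun i _ => by simp only [tbl]; split_ifs <;> simp)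
    (fun i hi f hf => by
      simp only [tbl] at hf
      split_ifs at hf with hii
      · rw [List.eq_of_mem_replicate hf]
        exact (Reach.of_mem (hFc false)).mono_size (Nat.zero_le _)
      · obtain ⟨j, rfl⟩ := List.mem_ofFn.1 hf
        exact hdep i hi hii fun v => (h.symm v).getD j false)
    (fun i hi => by
      by_cases hii : i = i₀
      · have : bad i = fun _ => true := by funext u; simp [bad, hii]
        rw [this]
        exact (Reach.of_mem (hFc true)).mono_size (Nat.zero_le _)
      · have : bad i = fun u => decide (B (h.symm (restrict n J i (a u))) ≠ b.testBit i) := by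
          
          funext u
          simp only [bad, if_neg hii, genBit]
          exact decide_eq_decide.2 Iff.rfl
        rw [this]
        exact hdep i hi hii fun v => decide (B (h.symm v) ≠ b.testBit i))
    (fun l hl f hf => by
      simp only [zl, List.mem_cons, List.not_mem_nil, or_false] at hl
      rcases hl with rfl | rfl | rfl | rfl
      · obtain ⟨j, hj, rfl⟩ := List.mem_map.1 hf
        rw [List.mem_range] at hj
        have h1 := fun u => hbit u ⟨j, hj⟩
        simp only at h1
        simp only [h1]
        by_cases hex : ∃ r, pos r = ⟨j, hj⟩
        · obtain ⟨r, hr⟩ := hex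
          simp only [← hr, hpos.extend_apply]
          exact hFr r
        · simp only [Function.extend_apply' _ _ _ hex]
          exact hFc _
      all_goals
        obtain ⟨c, _, rfl⟩ := List.mem_map.1 hf
        exact hFc c)
    (by
      have : (symbolicEncode zl).length =
          n * 2 + 1 + ((n + 1) * n * 2 + 1 + ((n + 1) * 2 + 1 + (p * 2 + 1))) := by
        simp [symbolicEncode, zl, bits, List.length_flatMap, Function.comp_def, List.map_const']
        ring
      rw [this, hU]
      nlinarith)
    (by rw [hU]; omega) (by rw [hU]; omega) (by rw [hU]; omega)
  refine ((hC.trans main).mono_right ?_).mono_size (by simp)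
  rw [Set.singleton_subset_iff, Set.mem_singleton_iff]
  funext u
  rw [hzl, decide_eq_decide]
  have htest : ((queries (n + 1) (tableReply (n + 1) ℓ tbl u) q.1.moves
        [bits n (a u), bits ((n + 1) * n) J, bits (n + 1) b, bits p w])[q.2]? = some i₀ ∧
      ∀ y ∈ idx, ∀ i : Fin (n + 1), ¬ ((queries (n + 1) (tableReply (n + 1) ℓ tbl u) y.1.moves
        [bits n (a u), bits ((n + 1) * n) J, bits (n + 1) b, bits p w])[y.2]? = some (i : ℕ) ∧
          bad i u = true)) ↔
      ((queries (n + 1) (tableReply (n + 1) ℓ tbl u) q.1.moves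
        [bits n (a u), bits ((n + 1) * n) J, bits (n + 1) b, bits p w])[q.2]? = some i₀ ∧
      ∀ y ∈ idx, ∀ i, (queries (n + 1) (tableReply (n + 1) ℓ tbl u) y.1.moves
        [bits n (a u), bits ((n + 1) * n) J, bits (n + 1) b, bits p w])[y.2]? = some i →
          i ≠ i₀ ∧ genBit h B n J (a u) i = b.testBit i) := by
    have hbad : ∀ i, bad i u = true ↔ ¬ (i ≠ i₀ ∧ genBit h B n J (a u) i = b.testBit i) := by
      intro i
      by_cases hii : i = i₀ <;> simp [bad, hii]
    refine and_congr_right fun _ => forall₂_congr fun y _ => ?_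
    constructor
    · intro h1 i hi
      have := h1 ⟨i, lt_of_getElem?_queries hi⟩
      simp only [hbad] at this
      by_contra hcon
      exact this ⟨hi, hcon⟩
    · rintro h1 i ⟨h2, h3⟩
      exact (hbad i).1 h3 (h1 i h2)
  rw [htest]
  exact ⟨fun h1 => getElem?_queries_test_congr (fun i hi hne => (hreply u i hi hne).symm) _ hq hidx h1,
    fun h1 => getElem?_queries_test_congr (fun i hi hne => hreply u i hi hne) _ hq hidx h1⟩

end NWGame

namespace NWGame

section Prediction

variable {h : Equiv.Perm (List Bool)} {B : List Bool → Bool}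

open Classical in
theorem IsHardBit.exists_forall_card_le (hhard : IsHardBit h B)
    (hlen : ∀ v, (h v).length = v.length) (q : Student × ℕ) (idx : List (Student × ℕ)) (e : ℕ)
    (hq : ∀ s < q.2, (q.1, s) ∈ idx) (hidx : ∀ y ∈ idx, ∀ s < y.2, (y.1, s) ∈ idx) :
    ∃ N, ∀ n ≥ N, ∀ J b p w, IsSetSystem n J → p ≤ n ^ e → ∀ i₀ < n + 1,
      ((Finset.univ.filter fun A : Fin n → Bool =>
        (roundQuery h n J b p w q (Nat.ofBits A) = some i₀ ∧
          ∀ y ∈ idx, ∀ i, roundQuery h n J b p w y (Nat.ofBits A) = some i →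
            i ≠ i₀ ∧ genBit h B n J (Nat.ofBits A) i = b.testBit i) ∧
        ¬ genBit h B n J (Nat.ofBits A) i₀ = b.testBit i₀).card : ℝ) ≤
      (Finset.univ.filter fun A : Fin n → Bool =>
        (roundQuery h n J b p w q (Nat.ofBits A) = some i₀ ∧
          ∀ y ∈ idx, ∀ i, roundQuery h n J b p w y (Nat.ofBits A) = some i →
            i ≠ i₀ ∧ genBit h B n J (Nat.ofBits A) i = b.testBit i) ∧
        genBit h B n J (Nat.ofBits A) i₀ = b.testBit i₀).card +
      2 * (2 ^ n / (Nat.nthRoot 3 n : ℝ) ^ 4) := by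
  obtain ⟨P, hP⟩ := exists_reach_roundQuery q idx e hq hidx
  obtain ⟨ℓ₀, hℓ₀⟩ := hhard.exists_forall_circuit
    ((2 * P + 7).comp ((Polynomial.X + 1) ^ 3)) (show 1 ≤ 4 by norm_num)
  refine ⟨ℓ₀ ^ 3, fun n hn J b p w hJ hp i₀ hi₀ => ?_⟩
  generalize hℓ : Nat.nthRoot 3 n = ℓ
  have hle : ℓ₀ ≤ ℓ := hℓ ▸ (Nat.le_nthRoot_iff (by norm_num)).2 hn
  have hnℓ : n ≤ (ℓ + 1) ^ 3 := hℓ ▸ (Nat.lt_pow_nthRoot_add_one (by norm_num) n).le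
  have hrowcard : (row n J i₀).card = ℓ := (hJ.2.1 i₀ hi₀).trans hℓ
  obtain ⟨pos, hpos, hrow, hres⟩ := exists_enumeration hrowcard
  let D : (Fin n → Bool) → Prop := fun A => roundQuery h n J b p w q (Nat.ofBits A) = some i₀ ∧
    ∀ y ∈ idx, ∀ i, roundQuery h n J b p w y (Nat.ofBits A) = some i →
      i ≠ i₀ ∧ genBit h B n J (Nat.ofBits A) i = b.testBit i
  let ok : (Fin n → Bool) → Prop := fun A => genBit h B n J (Nat.ofBits A) i₀ = b.testBit i₀
  change ((Finset.univ.filter fun A => D A ∧ ¬ ok A).card : ℝ) ≤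
    (Finset.univ.filter fun A => D A ∧ ok A).card + _
  have hfib : ∀ ρ : Fin n → Bool,
      ((Finset.univ.filter fun u : Fin ℓ → Bool =>
        D (Function.extend pos u ρ) ∧ ¬ ok (Function.extend pos u ρ)).card : ℝ) ≤
      (Finset.univ.filter fun u : Fin ℓ → Bool =>
        D (Function.extend pos u ρ) ∧ ok (Function.extend pos u ρ)).card +
      2 * (2 ^ ℓ / (ℓ : ℝ) ^ 4) := fun ρ => by
    have hok : ∀ u : Fin ℓ → Bool, ok (Function.extend pos u ρ) ↔
        B (h.symm (List.ofFn u)) = b.testBit i₀ := fun u => by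
      simp only [ok, genBit, hres]
      have : (fun r => (Nat.ofBits (Function.extend pos u ρ)).testBit (pos r : ℕ)) = u := by
        funext r
        rw [Nat.testBit_ofBits_lt _ _ (pos r).2, Fin.eta, hpos.extend_apply]
      rw [this]
    have := card_le_of_predictors (fun u : Fin ℓ → Bool => decide (D (Function.extend pos u ρ)))
      (fun u => B (h.symm (List.ofFn u))) (b.testBit i₀) (2 ^ ℓ / (ℓ : ℝ) ^ 4) fun c => ?_
    · simpa only [decide_eq_true_eq, hok] using this
    · have hr : Reach (Set.range fun (r : Fin ℓ) u => u r) (P.eval n)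
          {fun u => decide (D (Function.extend pos u ρ))} := by
        convert hP h hlen B n J b p w hJ hp i₀ hi₀ ℓ hrowcard pos hpos hrow ρ using 3
      have hr' := (hr.gate_and (Reach.constant (!b.testBit i₀))).gate_or
        (hr.gate_not.gate_and (Reach.constant c))
      obtain ⟨C, hC, hCe⟩ := hr'.exists_circuit_eval
      have hs := hℓ₀ ℓ hle C (by
        have := eval_mono P hnℓ
        simp only [Polynomial.eval_comp, Polynomial.eval_add, Polynomial.eval_mul,
          Polynomial.eval_ofNat, Polynomial.eval_pow, Polynomial.eval_X, Polynomial.eval_one]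
        omega)
      simp only [hCe] at hs
      rw [div_le_iff₀ (by positivity)] at hs
      refine hs.trans (le_of_eq ?_)
      rw [Fintype.card_fun, Fintype.card_bool, Fintype.card_fin]
      push_cast
      ring
  have hsum := Finset.sum_le_sum fun ρ (_ : ρ ∈ (Finset.univ : Finset (Fin n → Bool))) => hfib ρ
  rw [Finset.sum_add_distrib, ← Nat.cast_sum, ← Nat.cast_sum,
    sum_card_extend hpos fun A => D A ∧ ¬ ok A, sum_card_extend hpos fun A => D A ∧ ok A,
    Finset.sum_const, Finset.card_univ, Fintype.card_fun, Fintype.card_bool, Fintype.card_fin,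
    nsmul_eq_mul] at hsum
  push_cast at hsum
  have h2 : (0 : ℝ) < 2 ^ ℓ := by positivity
  refine le_of_mul_le_mul_left (hsum.trans (le_of_eq ?_)) h2
  ring

/-- Lists of rounds in which every round comes after the previous rounds of the same Student; the
last round is the head of the list. -/
inductive IsSchedule : List (Student × ℕ) → Prop
  | nil : IsSchedule []
  | cons {y : Student × ℕ} {l : List (Student × ℕ)} :
    IsSchedule l → (∀ s < y.2, (y.1, s) ∈ l) → IsSchedule (y :: l)

theorem IsSchedule.mem_of_lt {l : List (Student × ℕ)} (hl : IsSchedule l) :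
    ∀ y ∈ l, ∀ s < y.2, (y.1, s) ∈ l := by
  induction hl with
  | nil => simp
  | cons _ hy ih =>
    intro y' hy' s hs
    rw [List.mem_cons] at hy'
    rcases hy' with rfl | hy'
    · exact List.mem_cons_of_mem _ (hy s hs)
    · exact List.mem_cons_of_mem _ (ih y' hy' s hs)

theorem exists_isSchedule (l : List Student) :
    ∃ idx, IsSchedule idx ∧ ∀ S ∈ l, ∀ t < S.moves.length, (S, t) ∈ idx := by
  induction l with
  | nil => exact ⟨[], .nil, by simp⟩
  | cons S l ih =>
    obtain ⟨idx, h1, h2⟩ := ih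
    have key : ∀ k, ∃ idx', IsSchedule idx' ∧ (∀ y ∈ idx, y ∈ idx') ∧ ∀ t < k, (S, t) ∈ idx' := by
      intro k
      induction k with
      | zero => exact ⟨idx, h1, fun _ h => h, by simp⟩
      | succ k ih =>
        obtain ⟨idx', h1, h2, h3⟩ := ih
        refine ⟨(S, k) :: idx', h1.cons h3, fun y hy => List.mem_cons_of_mem _ (h2 y hy),
          fun t ht => ?_⟩
        rcases Nat.lt_succ_iff_lt_or_eq.1 ht with ht | rfl
        · exact List.mem_cons_of_mem _ (h3 t ht)
        · exact List.mem_cons_self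
    obtain ⟨idx', h3, h4, h5⟩ := key S.moves.length
    refine ⟨idx', h3, fun T hT t ht => ?_⟩
    rw [List.mem_cons] at hT
    rcases hT with rfl | hT
    · exact h5 t ht
    · exact h4 _ (h2 T hT t ht)

open Classical in
/-- The samples on which no query of the given rounds is bad. -/
noncomputable def surviving (h : Equiv.Perm (List Bool)) (B : List Bool → Bool) (n J b p w : ℕ)
    (idx : List (Student × ℕ)) : Finset (Fin n → Bool) :=
  Finset.univ.filter fun A => ∀ y ∈ idx, ∀ i,
    roundQuery h n J b p w y (Nat.ofBits A) = some i →
      genBit h B n J (Nat.ofBits A) i = b.testBit i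

theorem IsHardBit.exists_le_mul_card_surviving (hhard : IsHardBit h B)
    (hlen : ∀ v, (h v).length = v.length) {idx : List (Student × ℕ)} (hidx : IsSchedule idx)
    (e : ℕ) : ∃ K : ℕ, 0 < K ∧ ∃ N, ∀ n ≥ N, ∀ J b p w, IsSetSystem n J → p ≤ n ^ e →
      (2 : ℝ) ^ n ≤ K * (surviving h B n J b p w idx).card := by
  classical
  induction hidx with
  | nil =>
    refine ⟨1, one_pos, 0, fun n _ J b p w _ _ => ?_⟩
    simp [surviving]
  | @cons q l hl hq ih =>
    obtain ⟨K, hK, N, hN⟩ := ih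
    obtain ⟨N', hN'⟩ := hhard.exists_forall_card_le hlen q l e hq hl.mem_of_lt
    refine ⟨4 * K, by omega, max N (max N' ((32 * K) ^ 3)), fun n hn J b p w hJ hp => ?_⟩
    rw [ge_iff_le, max_le_iff, max_le_iff] at hn
    have hS := hN n hn.1 J b p w hJ hp
    have hpred := hN' n hn.2.1 J b p w hJ hp
    have hℓ : 32 * K ≤ Nat.nthRoot 3 n := (Nat.le_nthRoot_iff (by norm_num)).2 hn.2.2
    have hnℓ : n + 1 ≤ (Nat.nthRoot 3 n + 1) ^ 3 := Nat.lt_pow_nthRoot_add_one (by norm_num) n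
    generalize Nat.nthRoot 3 n = ℓ at hpred hℓ hnℓ
    have hfilter : ∀ i (R : (Fin n → Bool) → Prop) [DecidablePred R],
        ((surviving h B n J b p w l).filter fun A =>
          (roundQuery h n J b p w q (Nat.ofBits A) = some i ∧
            ¬ ∃ y ∈ l, roundQuery h n J b p w y (Nat.ofBits A) = some i) ∧ R A) =
        Finset.univ.filter fun A => (roundQuery h n J b p w q (Nat.ofBits A) = some i ∧
          ∀ y ∈ l, ∀ j, roundQuery h n J b p w y (Nat.ofBits A) = some j →
            j ≠ i ∧ genBit h B n J (Nat.ofBits A) j = b.testBit j) ∧ R A := by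
      intro i R _
      ext A
      simp only [surviving, Finset.mem_filter, Finset.mem_univ, true_and]
      constructor
      · rintro ⟨h1, ⟨h2, h3⟩, h4⟩
        exact ⟨⟨h2, fun y hy j hj => ⟨fun hji => h3 ⟨y, hy, hji ▸ hj⟩, h1 y hy j hj⟩⟩, h4⟩
      · rintro ⟨⟨h1, h2⟩, h3⟩
        exact ⟨fun y hy j hj => (h2 y hy j hj).2,
          ⟨h1, fun ⟨y, hy, hj⟩ => (h2 y hy i hj).1 rfl⟩, h3⟩
    have hstep := card_le_two_mul_card_surviving (surviving h B n J b p w l)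
      (fun A => roundQuery h n J b p w q (Nat.ofBits A)) (m := n + 1)
      (fun A i hi => lt_of_getElem?_queries hi)
      (fun i A => ∃ y ∈ l, roundQuery h n J b p w y (Nat.ofBits A) = some i)
      (fun i A => genBit h B n J (Nat.ofBits A) i = b.testBit i)
      (fun A hA i ⟨y, hy, hi⟩ => (Finset.mem_filter.1 hA).2 y hy i hi)
      (2 * (2 ^ n / (ℓ : ℝ) ^ 4)) fun i hi => by
        rw [hfilter, hfilter]
        convert hpred i hi
    have hsurv : ((surviving h B n J b p w l).filter fun A => ∀ i,
        roundQuery h n J b p w q (Nat.ofBits A) = some i →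
          genBit h B n J (Nat.ofBits A) i = b.testBit i) = surviving h B n J b p w (q :: l) := by
      ext A
      simp only [surviving, Finset.mem_filter, Finset.mem_univ, true_and, List.mem_cons,
        forall_eq_or_imp]
      exact and_comm
    rw [hsurv] at hstep
    have hK' : (1 : ℝ) ≤ K := by exact_mod_cast hK
    have hℓ' : 32 * (K : ℝ) ≤ ℓ := by exact_mod_cast hℓ
    have hℓ1 : (1 : ℝ) ≤ ℓ := by linarith
    have hn8 : ((n + 1 : ℕ) : ℝ) ≤ 8 * (ℓ : ℝ) ^ 3 := by
      have h1 : ((n + 1 : ℕ) : ℝ) ≤ ((ℓ : ℝ) + 1) ^ 3 := by exact_mod_cast hnℓ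
      have h2 : ((ℓ : ℝ) + 1) ^ 3 ≤ (2 * ℓ) ^ 3 := by gcongr; linarith
      calc _ ≤ _ := h1.trans h2
        _ = _ := by ring
    have hδ : (K : ℝ) * (((n + 1 : ℕ) : ℝ) * (2 * (2 ^ n / (ℓ : ℝ) ^ 4))) ≤ 2 ^ n / 2 := by
      calc (K : ℝ) * (((n + 1 : ℕ) : ℝ) * (2 * (2 ^ n / (ℓ : ℝ) ^ 4)))
          ≤ (K : ℝ) * ((8 * (ℓ : ℝ) ^ 3) * (2 * (2 ^ n / (ℓ : ℝ) ^ 4))) := by gcongr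
        _ = (16 * (K : ℝ) / ℓ) * 2 ^ n := by field_simp; ring
        _ ≤ (1 / 2) * 2 ^ n := by
          refine mul_le_mul_of_nonneg_right ?_ (by positivity)
          rw [div_le_div_iff₀ (by linarith) (by norm_num)]
          linarith
        _ = _ := by ring
    have hmul := mul_le_mul_of_nonneg_left hstep (zero_le_one.trans hK')
    push_cast at hδ hmul ⊢
    linarith

end Prediction

theorem Student.isSome_result_iff (S : Student) (h : Equiv.Perm (List Bool))
    (B : List Bool → Bool) (n J b p w a : ℕ) :
    (S.result h B n J b p w a).isSome = true ↔ ∀ t < S.moves.length, ∀ i,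
      roundQuery h n J b p w (S, t) a = some i → genBit h B n J a i = b.testBit i := by
  rw [Student.result, isSome_play_iff, List.append_nil]
  constructor
  · exact fun hq t _ i hi => hq i (List.mem_of_getElem? hi)
  · intro hq i hi
    obtain ⟨t, ht, rfl⟩ := List.getElem_of_mem hi
    refine hq t (ht.trans_le ?_) _ (List.getElem?_eq_getElem ht)
    refine (List.takeWhile_prefix _).length_le.trans ?_
    rw [length_queryRun]

theorem exists_forall_le_card_isSome_result (h : Equiv.Perm (List Bool))
    (hlen : ∀ v, (h v).length = v.length) (B : List Bool → Bool) (hhard : IsHardBit h B)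
    (l : List Student) (k e : ℕ) :
    ∃ N, ∀ n ≥ N, ∀ J b p w, IsSetSystem n J → p ≤ n ^ e →
      k ≤ ((Finset.range (2 ^ n)).filter fun a =>
        ∀ S ∈ l, (S.result h B n J b p w a).isSome = true).card := by
  obtain ⟨idx, hidx, hmem⟩ := exists_isSchedule l
  obtain ⟨K, hK, N, hN⟩ := hhard.exists_le_mul_card_surviving hlen hidx e
  refine ⟨max N (K * k), fun n hn J b p w hJ hp => ?_⟩
  rw [ge_iff_le, max_le_iff] at hn
  have h1 : 2 ^ n ≤ K * (surviving h B n J b p w idx).card := by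
    exact_mod_cast hN n hn.1 J b p w hJ hp
  have h2 : K * k ≤ K * (surviving h B n J b p w idx).card :=
    hn.2.trans (Nat.lt_two_pow_self.le.trans h1)
  refine (Nat.le_of_mul_le_mul_left h2 hK).trans ?_
  refine Finset.card_le_card_of_injOn (fun A => Nat.ofBits A) (fun A hA => ?_) fun A _ A' _ hAA => ?_
  · rw [Finset.mem_coe, Finset.mem_filter, Finset.mem_range]
    refine ⟨Nat.ofBits_lt_two_pow A, fun S hS => ?_⟩
    rw [Student.isSome_result_iff]
    exact fun t ht i hi => (Finset.mem_filter.1 hA).2 _ (hmem S hS t ht) i hi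
  · funext j
    have := congrArg (fun x => x.testBit j) hAA
    simpa [Nat.testBit_ofBits_lt _ _ j.2] using this

end NWGame

namespace NWGame

theorem exists_testBit_iff (s : Finset ℕ) : ∃ H : ℕ, ∀ a, H.testBit a = true ↔ a ∈ s := by
  classical
  induction s using Finset.induction_on with
  | empty => exact ⟨0, by simp⟩
  | insert a s _ ih =>
    obtain ⟨H, hH⟩ := ih
    refine ⟨H ||| 2 ^ a, fun a' => ?_⟩
    rw [Nat.testBit_or, Bool.or_eq_true, hH, Nat.testBit_two_pow, Finset.mem_insert,
      decide_eq_true_eq, or_comm, eq_comm]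

/-- The conditions on `H`, as relations on `(n, J, b, p, w)` and `H`: the Student is defined on all
samples from `H`, and `H` consists of at least `k` strings. -/
def sampleCondition (h : Equiv.Perm (List Bool)) (B : List Bool → Bool) :
    Student ⊕ ℕ → (Fin 5 → ℕ) → ℕ → Prop
  | .inl S, v, H => ∀ a, H.testBit a = true → (S.result h B (v 0) (v 1) (v 2) (v 3) (v 4) a).isSome
  | .inr k, v, H => (∀ a, H.testBit a = true → a < 2 ^ v 0) ∧
      ∃ f : Fin k → ℕ, (∀ i j, i ≠ j → f i ≠ f j) ∧ ∀ i, H.testBit (f i) = true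

section

variable {L : FirstOrder.Language.{u, v}} [L.Structure ℕ] (ι : arith →ᴸ L) [ι.IsExpansionOn ℕ]
  {α : Type}

include ι

theorem isDef_testBit (i j : α) : IsDef L fun v : α → ℕ => (v i).testBit (v j) = true :=
  (IsDef.of_primrecPred ι (R := fun v : Fin 2 → ℕ => (v 0).testBit (v 1) = true)
    (PrimrecRel.comp Primrec.eq (primrec_testBit.comp (primrec_apply 0) (primrec_apply 1))
      (Primrec.const true))).relabel ![i, j]

theorem isDef_isString (i j : α) : IsDef L fun v : α → ℕ => v j < 2 ^ v i :=
  (IsDef.of_primrecPred ι (R := fun v : Fin 2 → ℕ => v 1 < 2 ^ v 0)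
    (PrimrecRel.comp Primrec.nat_lt (primrec_apply 1)
      (primrec_pow.comp (Primrec.const 2) (primrec_apply 0)))).relabel ![i, j]

theorem isDef_ne (i j : α) : IsDef L fun v : α → ℕ => v i ≠ v j :=
  ((IsDef.of_primrecPred ι (R := fun v : Fin 2 → ℕ => v 0 = v 1)
    (PrimrecRel.comp Primrec.eq (primrec_apply 0) (primrec_apply 1))).relabel ![i, j]).not

theorem isDef_isSome_result {h : Equiv.Perm (List Bool)} (hsymm : Primrec h.symm)
    {B : List Bool → Bool} (hB : Primrec B) (S : Student) (e : Fin 6 → α) :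
    IsDef L fun v : α → ℕ => (S.result h B (v (e 0)) (v (e 1)) (v (e 2)) (v (e 3)) (v (e 4))
      (v (e 5))).isSome = true :=
  (IsDef.of_primrecPred ι (R := fun v : Fin 6 → ℕ =>
    (S.result h B (v 0) (v 1) (v 2) (v 3) (v 4) (v 5)).isSome = true)
    (PrimrecRel.comp Primrec.eq (Primrec.option_isSome.comp (S.primrec_result hsymm hB
      (primrec_apply 0) (primrec_apply 1) (primrec_apply 2) (primrec_apply 3) (primrec_apply 4)
      (primrec_apply 5))) (Primrec.const true))).relabel e

theorem isDef_result {h : Equiv.Perm (List Bool)} (hsymm : Primrec h.symm)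
    {B : List Bool → Bool} (hB : Primrec B) (S : Student) :
    IsDef L fun v : Fin 7 → ℕ => S.result h B (v 0) (v 1) (v 2) (v 3) (v 4) (v 5) = some (v 6) :=
  IsDef.of_primrecPred ι
    (PrimrecRel.comp Primrec.eq (S.primrec_result hsymm hB
      (primrec_apply 0) (primrec_apply 1) (primrec_apply 2) (primrec_apply 3) (primrec_apply 4)
      (primrec_apply 5)) (Primrec.option_some.comp (primrec_apply 6)))

theorem isDef_sampleCondition {h : Equiv.Perm (List Bool)} (hsymm : Primrec h.symm)
    {B : List Bool → Bool} (hB : Primrec B) (i : Student ⊕ ℕ) :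
    IsDef L fun v : Fin 5 ⊕ Unit → ℕ =>
      sampleCondition h B i (v ∘ Sum.inl) (v (Sum.inr ())) := by
  rcases i with S | k
  · refine IsDef.forall_nat (IsDef.imp ?_ ?_)
    · exact isDef_testBit ι (Sum.inl (Sum.inr ())) (Sum.inr ())
    · exact isDef_isSome_result ι hsymm hB S ![Sum.inl (Sum.inl 0), Sum.inl (Sum.inl 1),
        Sum.inl (Sum.inl 2), Sum.inl (Sum.inl 3), Sum.inl (Sum.inl 4), Sum.inr ()]
  · refine (IsDef.forall_nat (IsDef.imp ?_ ?_)).and (IsDef.exists_tuple (IsDef.and ?_ ?_))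
    · exact isDef_testBit ι (Sum.inl (Sum.inr ())) (Sum.inr ())
    · exact isDef_isString ι (Sum.inl (Sum.inl 0)) (Sum.inr ())
    · refine IsDef.forall_finite fun i => IsDef.forall_finite fun j => ?_
      by_cases hij : i = j
      · exact (isDef_ne ι (Sum.inr i) (Sum.inr i)).not.of_iff fun v => by simp [hij]
      · exact (isDef_ne ι (Sum.inr i) (Sum.inr j)).of_iff fun v => by simp [hij]
    · exact IsDef.forall_finite fun i => isDef_testBit ι (Sum.inl (Sum.inr ())) (Sum.inr i)

end

end NWGame

open NWGame

theorem mainTheorem2 {L : FirstOrder.Language.{u, v}} [L.Structure ℕ]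
    (ι : NWGame.arith →ᴸ L) [ι.IsExpansionOn ℕ]
    {M : Type x} [L.Structure M]
    (hM : M ⊨ L.completeTheory ℕ) (hsat : IsAleph1Saturated L M)
    (h : Equiv.Perm (List Bool)) (hlen : ∀ v, (h v).length = v.length) (hpoly : PolyTime h)
    (B : List Bool → Bool) (hBpoly : PolyTime fun v => [B v]) (hhard : IsHardBit h B)
    (n J b : M) (hn : IsNonstandard L n)
    (hJ : Holds L M (fun v : Fin 2 → ℕ => IsSetSystem (v 0) (v 1)) ![n, J])
    (hb : Holds L M (fun v : Fin 3 → ℕ => IsOutsideRange h B (v 0) (v 1) (v 2)) ![n, J, b])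
    (p w : M)
    (hp : ∃ k : ℕ, Holds L M (fun v : Fin 2 → ℕ => v 1 ≤ v 0 ^ k) ![n, p])
    (hw : IsString L p w) :
    ∃ H : M, (codedSet L H).Infinite ∧ (∀ a ∈ codedSet L H, IsString L n a) ∧
      ∀ α ∈ uniformFamily L h B n J b p w, ∀ a ∈ codedSet L H, (α a).Dom := by
  have hsymm := primrec_symm hlen hpoly.primrec
  have hB : Primrec B := Primrec.list_headI.comp hBpoly.primrec
  obtain ⟨e, hp⟩ := hp
  let x : Fin 5 → M := ![n, J, b, p, w]
  have hlarge : ∀ N : ℕ, HoldsAt L M (fun v : Fin 5 → ℕ => N ≤ v 0) x := by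
    intro N
    have hdef : ∀ k : ℕ, IsDef L fun v : Fin 1 → ℕ => v 0 = k := fun k =>
      IsDef.of_primrecPred ι (PrimrecRel.comp Primrec.eq (primrec_apply 0) (Primrec.const k))
    have h1 : ∀ k : ℕ, HoldsAt L M (fun v : Fin 1 → ℕ => ¬ v 0 = k) ![n] := fun k =>
      (holdsAt_or_not _ (hdef k) ![n]).resolve_left (hn k)
    have hle : ∀ k : ℕ, IsDef L fun v : Fin 1 → ℕ => k ≤ v 0 := fun k =>
      IsDef.of_primrecPred ι (PrimrecRel.comp Primrec.nat_le (Primrec.const k) (primrec_apply 0))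
    have h2 : HoldsAt L M (fun v : Fin 1 → ℕ => N ≤ v 0) ![n] := by
      induction N with
      | zero => exact (h1 0).mono hM (hle 0) fun v _ => Nat.zero_le _
      | succ N ih => exact (ih.and (h1 N)).mono hM (hle _) fun v hv => by omega
    exact h2.relabel' ![0] (by funext i; fin_cases i; rfl)
  obtain ⟨H, hH⟩ := hsat.exists_holdsAt hM (sampleCondition h B)
    (isDef_sampleCondition ι hsymm hB) x fun l => by
      obtain ⟨N, hN⟩ := exists_forall_le_card_isSome_result h hlen B hhard
        (l.filterMap fun i => i.getLeft?) ((l.filterMap fun i => i.getRight?).sum) e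
      have h1 : HoldsAt L M (fun v : Fin 5 → ℕ => IsSetSystem (v 0) (v 1)) x :=
        HoldsAt.relabel' hJ ![0, 1] (by funext i; fin_cases i <;> rfl)
      have h2 : HoldsAt L M (fun v : Fin 5 → ℕ => v 3 ≤ v 0 ^ e) x :=
        HoldsAt.relabel' hp ![0, 3] (by funext i; fin_cases i <;> rfl)
      refine ((hlarge N).and (h1.and h2)).mono hM (IsDef.exists_nat (IsDef.forall_mem l
        fun i _ => isDef_sampleCondition ι hsymm hB i)) fun v ⟨hv1, hv2, hv3⟩ => ?_
      have hcard := hN (v 0) hv1 (v 1) (v 2) (v 3) (v 4) hv2 hv3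
      obtain ⟨H, hH⟩ := exists_testBit_iff ((Finset.range (2 ^ v 0)).filter fun a =>
        ∀ S ∈ l.filterMap fun i => i.getLeft?,
          (S.result h B (v 0) (v 1) (v 2) (v 3) (v 4) a).isSome = true)
      refine ⟨H, fun i hi => ?_⟩
      rcases i with S | k
      · intro a ha
        rw [hH, Finset.mem_filter] at ha
        exact ha.2 S (List.mem_filterMap.2 ⟨_, hi, rfl⟩)
      · refine ⟨fun a ha => ?_, ?_⟩
        · rw [hH, Finset.mem_filter, Finset.mem_range] at ha
          exact ha.1
        · have hk : k ≤ (l.filterMap fun i => i.getRight?).sum :=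
            List.single_le_sum (by simp) _ (List.mem_filterMap.2 ⟨_, hi, rfl⟩)
          obtain ⟨t, hts, htk⟩ := Finset.exists_subset_card_eq (hk.trans hcard)
          refine ⟨fun i => (t.equivFinOfCardEq htk).symm i, fun i j hij heq => hij ?_, fun i => ?_⟩
          · exact (t.equivFinOfCardEq htk).symm.injective (Subtype.ext heq)
          · rw [hH]
            exact hts (Subtype.property _)
  have hbit : ∀ a ∈ codedSet L H, HoldsAt L M (fun v : (Fin 5 ⊕ Unit) ⊕ Unit → ℕ =>
      (v (Sum.inl (Sum.inr ()))).testBit (v (Sum.inr ())) = true)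
      (Sum.elim (Sum.elim x fun _ => H) fun _ => a) := fun a ha =>
    HoldsAt.relabel' (R := fun v : Fin 2 → ℕ => (v 0).testBit (v 1) = true) ha
      ![Sum.inl (Sum.inr ()), Sum.inr ()] (by funext i; fin_cases i <;> rfl)
  have hstring : ∀ a ∈ codedSet L H, IsString L n a := by
    intro a ha
    have hdef : IsDef L fun v : (Fin 5 ⊕ Unit) ⊕ Unit → ℕ =>
        ((v (Sum.inl (Sum.inr ()))).testBit (v (Sum.inr ())) = true →
          v (Sum.inr ()) < 2 ^ v (Sum.inl (Sum.inl 0))) :=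
      (isDef_testBit ι _ _).imp (isDef_isString ι _ _)
    have h1 := ((hH (Sum.inr 0)).mono hM
      (R' := fun v => ∀ f : Unit → ℕ, ((v (Sum.inr ())).testBit (f ()) = true →
        f () < 2 ^ v (Sum.inl 0))) ((IsDef.forall_nat hdef).of_iff fun v =>
          ⟨fun h a => h fun _ => a, fun h f => h (f ())⟩) fun v hv f => hv.1 (f ())).forall_tuple
        hM hdef fun _ => a
    exact (((hbit a ha).and h1).mono hM (isDef_isString ι (Sum.inl (Sum.inl 0)) (Sum.inr ()))
      fun v hv => hv.2 hv.1).of_relabel' hM (isDef_isString ι 0 1)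
        ![Sum.inl (Sum.inl 0), Sum.inr ()] (by funext i; fin_cases i <;> rfl)
  refine ⟨H, fun hfin => ?_, hstring, fun α hα a ha => ?_⟩
  · let k := hfin.toFinset.card + 1
    have hdef : IsDef L fun v : (Fin 5 ⊕ Unit) ⊕ Fin k → ℕ =>
        (∀ i j, i ≠ j → v (Sum.inr i) ≠ v (Sum.inr j)) ∧
        ∀ i, (v (Sum.inl (Sum.inr ()))).testBit (v (Sum.inr i)) = true := by
      refine IsDef.and ?_ (IsDef.forall_finite fun i => isDef_testBit ι _ _)
      refine IsDef.forall_finite fun i => IsDef.forall_finite fun j => ?_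
      by_cases hij : i = j
      · exact (isDef_ne ι (Sum.inr i) (Sum.inr i)).not.of_iff fun v => by simp [hij]
      · exact (isDef_ne ι (Sum.inr i) (Sum.inr j)).of_iff fun v => by simp [hij]
    obtain ⟨y, hy⟩ := ((hH (Sum.inr k)).mono hM
      (R' := fun v => ∃ f : Fin k → ℕ, (∀ i j, i ≠ j → f i ≠ f j) ∧
        ∀ i, (v (Sum.inr ())).testBit (f i) = true) (IsDef.exists_tuple hdef)
        fun v hv => hv.2).exists_tuple hM hdef
    have hinj : Function.Injective y := by
      intro i j hij
      by_contra hne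
      exact ((hy.mono hM (isDef_ne ι (Sum.inr i) (Sum.inr j)) fun v hv => hv.1 i j hne).ne hM) hij
    have hmem : ∀ i, y i ∈ hfin.toFinset := fun i => by
      rw [Set.Finite.mem_toFinset]
      exact (hy.mono hM (isDef_testBit ι (Sum.inl (Sum.inr ())) (Sum.inr i)) fun v hv =>
        hv.2 i).of_relabel' hM (isDef_testBit ι 0 1) ![Sum.inl (Sum.inr ()), Sum.inr i]
          (by funext i; fin_cases i <;> rfl)
    have := Finset.card_le_card_of_injOn (s := Finset.univ) y (fun i _ => hmem i) hinj.injOn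
    simp [k] at this
  · obtain ⟨S, hS⟩ := hα
    have hsome := isDef_isSome_result ι hsymm hB S ![Sum.inl (Sum.inl 0), Sum.inl (Sum.inl 1),
        Sum.inl (Sum.inl 2), Sum.inl (Sum.inl 3), Sum.inl (Sum.inl 4),
        (Sum.inr () : (Fin 5 ⊕ Unit) ⊕ Unit)]
    have hdef : IsDef L fun v : (Fin 5 ⊕ Unit) ⊕ Unit → ℕ =>
        ((v (Sum.inl (Sum.inr ()))).testBit (v (Sum.inr ())) = true →
          (S.result h B (v (Sum.inl (Sum.inl 0))) (v (Sum.inl (Sum.inl 1)))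
            (v (Sum.inl (Sum.inl 2))) (v (Sum.inl (Sum.inl 3))) (v (Sum.inl (Sum.inl 4)))
            (v (Sum.inr ()))).isSome = true) :=
      (isDef_testBit ι _ _).imp hsome
    have h1 := ((hH (Sum.inl S)).mono hM
      (R' := fun v => ∀ f : Unit → ℕ, ((v (Sum.inr ())).testBit (f ()) = true →
        (S.result h B (v (Sum.inl 0)) (v (Sum.inl 1)) (v (Sum.inl 2)) (v (Sum.inl 3))
          (v (Sum.inl 4)) (f ())).isSome = true)) ((IsDef.forall_nat hdef).of_iff fun v =>
          ⟨fun h a => h fun _ => a, fun h f => h (f ())⟩) fun v hv f => hv (f ())).forall_tuple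
        hM hdef fun _ => a
    have h2 := (((hbit a ha).and h1).mono hM hsome fun v hv => hv.2 hv.1).of_relabel' hM
      (R := fun v : Fin 6 → ℕ => (S.result h B (v 0) (v 1) (v 2) (v 3) (v 4) (v 5)).isSome = true)
      (isDef_isSome_result ι hsymm hB S id) ![Sum.inl (Sum.inl 0), Sum.inl (Sum.inl 1),
        Sum.inl (Sum.inl 2), Sum.inl (Sum.inl 3), Sum.inl (Sum.inl 4), Sum.inr ()]
        (y := ![n, J, b, p, w, a]) (by funext i; fin_cases i <;> rfl)
    have hdef' := (isDef_result ι hsymm hB S).relabel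
      ![Sum.inl 0, Sum.inl 1, Sum.inl 2, Sum.inl 3, Sum.inl 4, Sum.inl 5,
        (Sum.inr () : Fin 6 ⊕ Unit)]
    obtain ⟨y, hy⟩ := (h2.mono hM (R' := fun v => ∃ f : Unit → ℕ,
      S.result h B (v 0) (v 1) (v 2) (v 3) (v 4) (v 5) = some (f ())) (IsDef.exists_tuple hdef')
      fun v hv => (Option.isSome_iff_exists.1 hv).imp' (fun y _ => y) fun y hy => hy).exists_tuple
        hM hdef'
    have h3 := hy.of_relabel' hM (isDef_result ι hsymm hB S) ![Sum.inl 0, Sum.inl 1, Sum.inl 2,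
      Sum.inl 3, Sum.inl 4, Sum.inl 5, Sum.inr ()] (y := ![n, J, b, p, w, a, y ()])
      (by funext i; fin_cases i <;> rfl)
    exact Part.dom_iff_mem.2 ⟨y (), (hS a (y ())).2 ⟨hstring a ha, h3⟩⟩
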